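/- Let $Q$ be a (Hausdorff, smooth) manifold, $\tau_A\colon A\to Q$ a smooth vector bundle of finite rank $n$ with dual bundle $\tau_{A^*}\colon A^*\to Q$, and let $\Pi_{A^*}$ be a linear Poisson structure on $A^*$, i.e. a Poisson $2$-vector on the manifold $A^*$ whose bracket $\{F,G\}=\Pi_{A^*}(dF,dG)$ of two fiberwise linear functions is again fiberwise linear. For $F\in C^\infty(A^*)$ let $X_F=-i(dF)\Pi_{A^*}=-\Pi_{A^*}(dF,\cdot)$ be its Hamiltonian vector field, and let $\Delta_{A^*}(\alpha)=\frac{d}{dt}\big|_{t=0}(1+t)\alpha$ be the Liouville vector field. Let $g$ be a smooth bundle metric on $A$ (with induced norm $\|\cdot\|_g$ on $A^*$), $V\in C^\infty(Q)$, and $$\kappa_g(\alpha_q)=\tfrac12\|\alpha_q\|_g^2,\qquad H(\alpha_q)=\kappa_g(\alpha_q)+V(q)\qquad(\alpha_q\in A_q^*).$$ Let $e\in\mathbb R$ be such that $U_e=\{q\in Q: V(q)<e\}$ is non-empty, let $A_e^*=\tau_{A^*}^{-1}(U_e)$, let $g_e=2(e-V)g$ be the Jacobi bundle metric over $U_e$,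 with kinetic Hamiltonian $\kappa_{g_e}(\alpha_q)=\frac12\|\alpha_q\|_{g_e}^2$ on $A_e^*$, and let $$S=\mathbb S_{g_e}(A^*)=\{\alpha\in A_e^*:\kappa_{g_e}(\alpha)=\tfrac12\}.$$ Then $S=\{\alpha\in A^*_e: H(\alpha)=e\}$, and: 1. $S$ is an (embedded) submanifold of codimension $1$ in $A_e^*$, and for $\alpha\in S$ $$T_\alpha S=\{w\in T_\alpha A_e^*:\langle dH(\alpha),w\rangle=0\}=\{w\in T_\alpha A_e^*:\langle d\kappa_{g_e}(\alpha),w\rangle=0\}.$$ 2. $\tau_{A^*}|_S\colon S\to U_e$ is a smooth locally trivial bundle whose fibre over $q\in U_e$ is the sphere of centre $0_q$ and radius $\sqrt{2(e-V(q))}$ in $A_q^*$ with respect to $g$; for $n\ge 1$ the local trivializations are diffeomorphisms onto products of open subsets of $U_e$ with the unit sphere of $\mathbb R^n$ (for $n=0$, $S$ is empty). 3. $X_H$ and $X_{\kappa_{g_e}}$ are tangent to $S$ along $S$, and for every $\alpha\in S$ $$X_H(\alpha)=2\big(e-V(\tau_{A^*}(\alpha))\big)\,X_{\kappa_{g_e}}(\alpha).$$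 4. $S$ carries a Jacobi structure $(\Lambda_S,E_S)$, i.e. a smooth $2$-vector $\Lambda_S$ and a smooth vector field $E_S$ on $S$ with $[\Lambda_S,\Lambda_S]=2\Lambda_S\wedge E_S$ and $\mathcal L_{E_S}\Lambda_S=0$ (Schouten–Nijenhuis bracket, with the sign convention $[\Lambda,\Lambda](df,dg,dh)=2\sum_{\rm cyc}\Lambda(d(\Lambda(df,dg)),dh)$), such that, under the inclusion $S\subset A^*$, $$\Lambda_S=\Big(\Pi_{A^*}+\frac{1}{2(e-V)}\,\Delta_{A^*}\wedge X_H\Big)\Big|_{S},\qquad E_S=-\frac{1}{2(e-V)}\,X_H\Big|_{S}.$$ 5. Let $c\colon I\to A_e^*$ and $c_e\colon I_e\to A_e^*$ be integral curves of $X_H$ and of $X_{\kappa_{g_e}}$ respectively, defined on open intervals containing $0$, with $c(0)=c_e(0)\in S$. Then there is a strictly increasing function $h\colon I\to\mathbb R$ with $$h(0)=0,\qquad \frac{dh}{ds}(s)=2\big(e-V(\tau_{A^*}(c(s)))\big)\quad(s\in I),$$ such that $c(s)=c_e(h(s))$ for all $s\in I$ with $h(s)\in I_e$. If $c_e$ is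 a maximal integral curve in $A_e^*$, then $h(I)\subseteq I_e$, so that $c=c_e\circ h$ on $I$; if moreover $c$ is maximal in $A_e^*$, then $h$ is a bijection of $I$ onto $I_e$. -/

import Mathlib

open Set Bundle
open scoped Manifold ContDiff Topology EuclideanSpace

noncomputable section

namespace JacobiMaupertuis

section Manifolds

variable {E : Type*} [NormedAddCommGroup E] [NormedSpace ℝ E]
  {H : Type*} [TopologicalSpace H] (I : ModelWithCorners ℝ E H)
  {M : Type*} [TopologicalSpace M] [ChartedSpace H M]

/-- A field of contravariant `2`-tensors `Λ` on a finite-dimensional manifold, given through the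
linear maps `Λ♯ : T*ₓM → TₓM`, `α ↦ i(α)Λ = Λ(α, ·)`, so that `Λ(α, β) = β (Λ♯ α)`. -/
abbrev TwoTensorField (M : Type*) [TopologicalSpace M] [ChartedSpace H M] : Type _ :=
  (x : M) → (TangentSpace I x →L[ℝ] ℝ) →ₗ[ℝ] TangentSpace I x

variable {I}

/-- The function `Λ(df, dg)`. -/
def pairing (Λ : TwoTensorField I M) (f g : M → ℝ) (x : M) : ℝ :=
  mvfderiv I g x (Λ x (mvfderiv I f x))

/-- The function `X(f) = ⟨df, X⟩`. -/
def derivAlong (X : (x : M) → TangentSpace I x) (f : M → ℝ) (x : M) : ℝ :=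
  mvfderiv I f x (X x)

/-- `Λ` is a smooth `2`-vector: `Λ(α, α) = 0` for every covector `α`, and `Λ(df, dg)` is smooth for
all smooth functions `f`, `g`. -/
structure IsTwoVector (Λ : TwoTensorField I M) : Prop where
  skew : ∀ (x : M) (α : TangentSpace I x →L[ℝ] ℝ), α (Λ x α) = 0
  smooth : ∀ f g : M → ℝ, CMDiff ∞ f → CMDiff ∞ g → CMDiff ∞ (pairing Λ f g)

/-- The wedge product of two tangent vectors,
`(u ∧ v)(α, β) = α(u) β(v) - α(v) β(u)`. -/
def wedge {x : M} (u v : TangentSpace I x) :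
    (TangentSpace I x →L[ℝ] ℝ) →ₗ[ℝ] TangentSpace I x where
  toFun α := α u • v - α v • u
  map_add' α β := by
    simp only [add_apply, add_smul]; abel
  map_smul' c α := by
    simp only [smul_apply, smul_eq_mul, mul_smul, smul_sub, RingHom.id_apply]

/-- The Schouten-Nijenhuis bracket `[Λ, Λ]`, a `3`-vector, evaluated on `df`, `dg`, `dh`:
`[Λ, Λ](df, dg, dh) = 2 (Λ(d(Λ(df, dg)), dh) + cyclic permutations)`. -/
def schouten (Λ : TwoTensorField I M) (f g h : M → ℝ) (x : M) : ℝ :=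
  2 * (pairing Λ (pairing Λ f g) h x + pairing Λ (pairing Λ g h) f x
    + pairing Λ (pairing Λ h f) g x)

/-- The `3`-vector `Λ ∧ X` evaluated on `df`, `dg`, `dh`. -/
def wedgeThree (Λ : TwoTensorField I M) (X : (x : M) → TangentSpace I x) (f g h : M → ℝ)
    (x : M) : ℝ :=
  pairing Λ f g x * derivAlong X h x + pairing Λ g h x * derivAlong X f x
    + pairing Λ h f x * derivAlong X g x

/-- The Lie derivative `L_X Λ` of a `2`-vector, evaluated on `df`, `dg`. -/
def lieDerivative (X : (x : M) → TangentSpace I x) (Λ : TwoTensorField I M) (f g : M → ℝ)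
    (x : M) : ℝ :=
  derivAlong X (pairing Λ f g) x - pairing Λ (derivAlong X f) g x - pairing Λ f (derivAlong X g) x

/-- A Poisson structure: a smooth `2`-vector `Λ` with `[Λ, Λ] = 0`, that is, whose bracket
`{f, g} = Λ(df, dg)` satisfies the Jacobi identity. Identities of multivectors are tested on
differentials of smooth functions, which span all cotangent spaces. -/
structure IsPoisson (Λ : TwoTensorField I M) : Prop extends IsTwoVector Λ where
  schouten_eq_zero : ∀ f g h : M → ℝ, CMDiff ∞ f → CMDiff ∞ g → CMDiff ∞ h →
    ∀ x, schouten Λ f g h x = 0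

/-- A Jacobi structure `(Λ, X)`: a smooth `2`-vector `Λ` and a smooth vector field `X` with
`[Λ, Λ] = 2 Λ ∧ X` and `L_X Λ = 0`. -/
structure IsJacobi [IsManifold I ∞ M] (Λ : TwoTensorField I M) (X : (x : M) → TangentSpace I x) : Prop
    extends IsTwoVector Λ where
  smooth_reeb : ContMDiff I I.tangent ∞ (fun x ↦ (⟨x, X x⟩ : TangentBundle I M))
  schouten_eq : ∀ f g h : M → ℝ, CMDiff ∞ f → CMDiff ∞ g → CMDiff ∞ h →
    ∀ x, schouten Λ f g h x = 2 * wedgeThree Λ X f g h x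
  lieDerivative_eq_zero : ∀ f g : M → ℝ, CMDiff ∞ f → CMDiff ∞ g →
    ∀ x, lieDerivative X Λ f g x = 0

/-- The Hamiltonian vector field `X_f = -i(df)Λ`, that is, `X_f(g) = Λ(dg, df)` for skew `Λ`. -/
def hamiltonianField (Λ : TwoTensorField I M) (f : M → ℝ) (x : M) : TangentSpace I x :=
  -Λ x (mvfderiv I f x)

/-- `c` is a trajectory of the vector field `X` inside the open set `W`, defined on the open
interval `J ∋ 0`. Values of `c` outside `J` are irrelevant. -/
structure IsTrajectory (X : (x : M) → TangentSpace I x) (W : Set M) (c : ℝ → M) (J : Set ℝ) :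
    Prop where
  isOpen : IsOpen J
  ordConnected : J.OrdConnected
  zero_mem : (0 : ℝ) ∈ J
  mapsTo : MapsTo c J W
  integral : IsMIntegralCurveOn c X J

/-- A trajectory inside `W` that is not the restriction of a trajectory inside `W` defined on a
larger interval. -/
structure IsMaximalTrajectory (X : (x : M) → TangentSpace I x) (W : Set M) (c : ℝ → M)
    (J : Set ℝ) : Prop extends IsTrajectory X W c J where
  maximal : ∀ (c' : ℝ → M) (J' : Set ℝ), IsTrajectory X W c' J' → J ⊆ J' → EqOn c' c J → J' = J

end Manifolds

section Bundles

variable {E : Type*} [NormedAddCommGroup E] [NormedSpace ℝ E]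
  {Q : Type*} [TopologicalSpace Q] [ChartedSpace E Q]
  (F : Type*) [NormedAddCommGroup F] [NormedSpace ℝ F]
  (A : Q → Type*) [TopologicalSpace (TotalSpace F A)]
  [∀ q, TopologicalSpace (A q)] [∀ q, AddCommGroup (A q)] [∀ q, Module ℝ (A q)]
  [∀ q, IsTopologicalAddGroup (A q)] [∀ q, ContinuousSMul ℝ (A q)]
  [FiberBundle F A] [VectorBundle ℝ F A]

/-- The total space of the dual bundle `A*`. -/
abbrev DualBundle : Type _ := TotalSpace (F →L[ℝ] ℝ) (fun q : Q ↦ A q →L[ℝ] ℝ)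

/-- The model with corners of the manifold `A*`. -/
abbrev dualModel (E : Type*) [NormedAddCommGroup E] [NormedSpace ℝ E]
    (F : Type*) [NormedAddCommGroup F] [NormedSpace ℝ F] :
    ModelWithCorners ℝ (E × (F →L[ℝ] ℝ)) (ModelProd E (F →L[ℝ] ℝ)) :=
  𝓘(ℝ, E).prod 𝓘(ℝ, F →L[ℝ] ℝ)

variable {F A}

/-- A smooth function on `A*` whose restriction to each fibre is linear. -/
structure IsFiberwiseLinear (f : DualBundle F A → ℝ) : Prop where
  smooth : ContMDiff (dualModel E F) 𝓘(ℝ, ℝ) ∞ f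
  linear : ∀ q : Q, IsLinearMap ℝ (fun α : A q →L[ℝ] ℝ ↦ f ⟨q, α⟩)

/-- A linear Poisson structure on `A*`: the bracket of two fiberwise linear functions is again
fiberwise linear. -/
structure IsLinearPoisson (P : TwoTensorField (dualModel E F) (DualBundle F A)) : Prop
    extends IsPoisson P where
  pairing_linear : ∀ f g : DualBundle F A → ℝ, IsFiberwiseLinear (E := E) f →
    IsFiberwiseLinear (E := E) g → IsFiberwiseLinear (E := E) (pairing P f g)

variable (E) in
/-- The Liouville vector field of `A*`: `Δ(α) = d/dt|_{t = 0} (1 + t) α`. -/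
def liouville (α : DualBundle F A) : TangentSpace (dualModel E F) α :=
  mfderiv 𝓘(ℝ, ℝ) (dualModel E F)
    (fun t : ℝ ↦ (⟨α.1, (1 + t) • α.2⟩ : DualBundle F A)) 0 (1 : ℝ)

/-- The squared norm `‖α‖_b² = ⟨α, b⁻¹ α⟩` of a covector with respect to a (nondegenerate) scalar
product `b` on `A_q`, which is regarded as an isomorphism `b : A_q → A_q*`. -/
def dualNormSq {q : Q} (b : A q →L[ℝ] A q →L[ℝ] ℝ) (α : A q →L[ℝ] ℝ) : ℝ :=
  α (b.inverse α)

/-- The kinetic Hamiltonian `κ_b(α) = ½ ‖α‖_b²` of a field of scalar products `b`. -/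
def kinetic (b : (q : Q) → A q →L[ℝ] A q →L[ℝ] ℝ) (α : DualBundle F A) : ℝ :=
  dualNormSq (b α.1) α.2 / 2

/-- The mechanical Hamiltonian `κ_b + V`. -/
def mechanical (b : (q : Q) → A q →L[ℝ] A q →L[ℝ] ℝ) (V : Q → ℝ) (α : DualBundle F A) : ℝ :=
  kinetic b α + V α.1

/-- The Jacobi metric `2 (e - V) b`; it is a metric over `U_e = {V < e}` only. -/
def jacobiMetric (b : (q : Q) → A q →L[ℝ] A q →L[ℝ] ℝ) (V : Q → ℝ) (e : ℝ) (q : Q) :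
    A q →L[ℝ] A q →L[ℝ] ℝ :=
  (2 * (e - V q)) • b q

variable (F A) in
/-- The open subset `A*_e` of `A*`, the part over `U_e = {V < e}`. -/
def dualOver (V : Q → ℝ) (e : ℝ) : Set (DualBundle F A) := {α | V α.1 < e}

variable (F) in
/-- The unit sphere bundle of the Jacobi metric, the level set `κ_{g_e} = 1/2` in `A*_e`. -/
def sphereBundle (b : (q : Q) → A q →L[ℝ] A q →L[ℝ] ℝ) (V : Q → ℝ) (e : ℝ) :
    Set (DualBundle F A) :=
  {α | α ∈ dualOver F A V e ∧ kinetic (jacobiMetric b V e) α = 1 / 2}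

end Bundles

end JacobiMaupertuis

end

/-!
The unit sphere bundle `S` of the Jacobi metric, its Jacobi structure, and the comparison of the
two Hamiltonian flows along it.

Let `O ⊆ A*` be the open cone of the nonzero covectors over `{V < e}` and let `ρ = √(2 κ)` be the
norm of the Jacobi metric, with `κ` its kinetic energy. The function `ρ` is smooth and positive on
`O`, homogeneous of degree one under the dilations of the fibres, and `S = {ρ = 1}`. As
`H - e = 2 (e - V) (κ - 1/2)`, one has `dκ = dρ` and `dH = 2 (e - V) dκ` along `S`. So there the
differentials of `H`, `κ` and `ρ` have the same kernel, and the Hamiltonian fields of these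
functions are proportional.

* `S` is an embedded submanifold since it has slice charts: a covector is described by its base
  point, the direction of its fibre coordinate (in an affine chart of the space of rays), and
  `ρ - 1`; see `IsNormedCone.exists_isSliceChart` and `exists_isSmoothEmbedding_of_isSliceChart`. Its
  tangent spaces are the kernels of `dρ` because the radial retraction `r : O → S`,
  `x ↦ x / ρ(x)`, has the differential `w ↦ w - dρ(w) Δ` at points of `S`.
* `S` is locally trivial over `{V < e}`: in a trivialization of `A*` the covector `(q, y)` goes to
  `(q, y / ‖y‖)`, and `r` provides the inverse (`exists_trivialization_sphereBundle`).
* Off the zero section the differentials of the fibrewise linear functions span all cotangent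
  spaces (`exists_isFiberwiseLinear_mvfderiv_eq`). Hence a linear Poisson structure has weight
  `-1` under the dilations (`IsLinearPoisson.isHomogeneous`).
* The Jacobi structure of `S` is the image of the Poisson structure under `r`, with Reeb field the
  image of `-X_ρ`. The bracket of two functions `f ∘ r` and `g ∘ r` of degree zero has degree
  `-1`, so that `Λ_S(df, dg) ∘ r = ρ {f ∘ r, g ∘ r}` and `E_S(f) ∘ r = {ρ, f ∘ r}`. The Leibniz
  rule turns the Jacobi identity on `O` into the identities of a Jacobi structure
  (`isJacobi_of_retraction`, `IsNormedCone.exists_isJacobi`).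
* Both Hamiltonian fields preserve `S`, and on it they differ by the positive factor `2 (e - V)`.
  The time change `h` is the integral of this factor along a trajectory. By uniqueness of integral
  curves it relates the two trajectories, and the time change in the other direction is its
  inverse (`exists_reparametrization`, `exists_reparametrization_bijOn`).
-/

noncomputable section

set_option linter.unusedSectionVars false

namespace JacobiMaupertuis

/-! ### Test functions and smoothness of vector fields -/

section TestFunctions

variable {E : Type*} [NormedAddCommGroup E] [NormedSpace ℝ E]
  {H : Type*} [TopologicalSpace H] {I : ModelWithCorners ℝ E H}
  {M : Type*} [TopologicalSpace M] [ChartedSpace H M]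

lemma mvfderiv_congr {f g : M → ℝ} {x : M} (h : f =ᶠ[𝓝 x] g) :
    mvfderiv I f x = mvfderiv I g x := by
  ext v
  simp only [mvfderiv, h.mfderiv_eq]
  rfl

lemma pairing_congr {P : TwoTensorField I M} {f f' g g' : M → ℝ} {x : M}
    (hf : f =ᶠ[𝓝 x] f') (hg : g =ᶠ[𝓝 x] g') : pairing P f g =ᶠ[𝓝 x] pairing P f' g' := by
  filter_upwards [hf.eventuallyEq_nhds, hg.eventuallyEq_nhds] with y hy hy'
  simp only [pairing, mvfderiv_congr hy, mvfderiv_congr hy']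

/-- The coordinates of a tangent vector are given by the differential of the chart. -/
lemma trivializationAt_tangent_apply [IsManifold I ∞ M] {x₀ x : M} (hx : x ∈ (chartAt H x₀).source)
    (v : TangentSpace I x) :
    (trivializationAt E (TangentSpace I) x₀ ⟨x, v⟩).2 = mvfderiv I (extChartAt I x₀) x v := by
  rw [← Trivialization.continuousLinearMapAt_apply_of_mem (R := ℝ) _ (by simpa using hx)]
  exact congrArg (fun T : TangentSpace I x →L[ℝ] E ↦ T v)
    (TangentBundle.continuousLinearMapAt_trivializationAt hx)

variable [FiniteDimensional ℝ E] [T2Space M] [IsManifold I ∞ M]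

/-- A smooth function on an open set agrees near any point of it with a globally smooth one. -/
lemma exists_contMDiff_eventuallyEq {G : Type*} [NormedAddCommGroup G] [NormedSpace ℝ G]
    {f : M → G} {O : Set M} (hO : IsOpen O) (hf : ContMDiffOn I 𝓘(ℝ, G) ∞ f O) {x : M}
    (hx : x ∈ O) : ∃ f' : M → G, ContMDiff I 𝓘(ℝ, G) ∞ f' ∧ f =ᶠ[𝓝 x] f' := by
  obtain ⟨φ, -, hφ⟩ := (SmoothBumpFunction.nhds_basis_tsupport (I := I) x).mem_iff.1
    (hO.mem_nhds hx)
  refine ⟨fun y ↦ φ y • f y, contMDiff_of_tsupport fun y hy ↦ ?_, ?_⟩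
  · exact φ.contMDiffAt.smul
      (hf.contMDiffAt (hO.mem_nhds (hφ (tsupport_smul_subset_left (φ : M → ℝ) f hy))))
  · filter_upwards [φ.eventuallyEq_one] with y hy
    simp [hy]

lemma IsTwoVector.contMDiffOn_pairing {P : TwoTensorField I M} (hP : IsTwoVector P)
    {f g : M → ℝ} {O : Set M} (hO : IsOpen O) (hf : CMDiff[O] ∞ f) (hg : CMDiff[O] ∞ g) :
    CMDiff[O] ∞ (pairing P f g) := by
  intro x hx
  obtain ⟨f', hf', hff⟩ := exists_contMDiff_eventuallyEq hO hf hx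
  obtain ⟨g', hg', hgg⟩ := exists_contMDiff_eventuallyEq hO hg hx
  exact ((hP.smooth f' g' hf' hg').contMDiffAt.congr_of_eventuallyEq
    (pairing_congr hff hgg)).contMDiffWithinAt

/-- The Jacobi identity holds for functions that are only defined on an open set. -/
lemma IsPoisson.schouten_eq_zero_of_contMDiffOn {P : TwoTensorField I M} (hP : IsPoisson P)
    {f g h : M → ℝ} {O : Set M} (hO : IsOpen O) (hf : CMDiff[O] ∞ f) (hg : CMDiff[O] ∞ g)
    (hh : CMDiff[O] ∞ h) {x : M} (hx : x ∈ O) : schouten P f g h x = 0 := by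
  obtain ⟨f', hf', hff⟩ := exists_contMDiff_eventuallyEq hO hf hx
  obtain ⟨g', hg', hgg⟩ := exists_contMDiff_eventuallyEq hO hg hx
  obtain ⟨h', hh', hhh⟩ := exists_contMDiff_eventuallyEq hO hh hx
  rw [← hP.schouten_eq_zero f' g' h' hf' hg' hh' x]
  simp only [schouten]
  rw [(pairing_congr (pairing_congr hff hgg) hhh).eq_of_nhds,
    (pairing_congr (pairing_congr hgg hhh) hff).eq_of_nhds,
    (pairing_congr (pairing_congr hhh hff) hgg).eq_of_nhds]

/-- A vector field is smooth as soon as it maps smooth functions to smooth functions: its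
components in a chart are its values on the coordinate functions, cut off by a bump function. -/
lemma contMDiffAt_of_derivAlong {X : (x : M) → TangentSpace I x} {x₀ : M}
    (hX : ∀ f : M → ℝ, CMDiff ∞ f → CMDiffAt ∞ (derivAlong X f) x₀) :
    ContMDiffAt I I.tangent ∞ (fun x ↦ (⟨x, X x⟩ : TangentBundle I M)) x₀ := by
  rw [contMDiffAt_section]
  have key (l : E →L[ℝ] ℝ) : CMDiffAt ∞
      (fun x ↦ l (trivializationAt E (TangentSpace I) x₀ ⟨x, X x⟩).2) x₀ := by
    have hl : CMDiff[(chartAt H x₀).source] ∞ (l ∘ extChartAt I x₀) :=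
      l.contMDiff.comp_contMDiffOn contMDiffOn_extChartAt
    obtain ⟨f', hf', hff⟩ := exists_contMDiff_eventuallyEq (chartAt H x₀).open_source hl
      (mem_chart_source H x₀)
    refine (hX f' hf').congr_of_eventuallyEq ?_
    filter_upwards [hff.eventuallyEq_nhds, (chartAt H x₀).open_source.mem_nhds
      (mem_chart_source H x₀)] with x hx hxs
    rw [derivAlong, ← mvfderiv_congr hx, trivializationAt_tangent_apply hxs]
    simp only [mvfderiv, mfderiv_comp x (I := I) (I' := 𝓘(ℝ, E)) (I'' := 𝓘(ℝ, ℝ)) (g := l)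
      (f := extChartAt I x₀) l.mdifferentiableAt (mdifferentiableAt_extChartAt hxs)]
    simp
    rfl
  let L := (Module.finBasis ℝ E).equivFunL
  have : ContMDiffAt I 𝓘(ℝ, Fin (Module.finrank ℝ E) → ℝ) ∞
      (fun x ↦ L (trivializationAt E (TangentSpace I) x₀ ⟨x, X x⟩).2) x₀ := by
    rw [contMDiffAt_pi_space]
    intro i
    exact key ((ContinuousLinearMap.proj (R := ℝ) (φ := fun _ ↦ ℝ) i).comp (L : E →L[ℝ] _))
  have h2 := L.symm.contDiff.contMDiff.contMDiffAt.comp x₀ this (n := ∞)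
  refine h2.congr_of_eventuallyEq (Filter.Eventually.of_forall fun x ↦ ?_)
  simp

lemma contMDiff_of_derivAlong {X : (x : M) → TangentSpace I x}
    (hX : ∀ f : M → ℝ, CMDiff ∞ f → CMDiff ∞ (derivAlong X f)) :
    ContMDiff I I.tangent ∞ (fun x ↦ (⟨x, X x⟩ : TangentBundle I M)) :=
  fun _ ↦ contMDiffAt_of_derivAlong fun f hf ↦ (hX f hf).contMDiffAt

end TestFunctions

/-! ### Submanifolds from slice charts -/

section Slices

variable {E E' G : Type*} [NormedAddCommGroup E] [NormedSpace ℝ E]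
  [NormedAddCommGroup E'] [NormedSpace ℝ E'] [NormedAddCommGroup G] [NormedSpace ℝ G]
  {H : Type*} [TopologicalSpace H] {I : ModelWithCorners ℝ E H}
  {M : Type*} [TopologicalSpace M] [ChartedSpace H M]

variable (I) in
/-- A slice chart of the subset `S` of `M`: a diffeomorphism of an open subset of `M` onto an open
subset of `E' × G` that maps `S` to the slice `E' × {0}`. -/
structure IsSliceChart (S : Set M) (Θ : OpenPartialHomeomorph M (E' × G)) : Prop where
  contMDiffOn : ContMDiffOn I 𝓘(ℝ, E' × G) ∞ Θ Θ.source
  contMDiffOn_symm : ContMDiffOn 𝓘(ℝ, E' × G) I ∞ Θ.symm Θ.target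
  mem_iff : ∀ y ∈ Θ.source, y ∈ S ↔ (Θ y).2 = 0

open Classical in
/-- The chart of `S` cut out by a slice chart. The point `x` only serves as a default value
outside the target. -/
def IsSliceChart.chart {S : Set M} {Θ : OpenPartialHomeomorph M (E' × G)}
    (hΘ : IsSliceChart I S Θ) (x : S) : OpenPartialHomeomorph S E' where
  toFun y := (Θ y).1
  invFun z := if h : Θ.symm (z, 0) ∈ S then ⟨Θ.symm (z, 0), h⟩ else x
  source := Subtype.val ⁻¹' Θ.source
  target := {z | (z, 0) ∈ Θ.target}
  map_source' y hy := by
    have h0 := (hΘ.mem_iff y hy).1 y.2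
    have : ((Θ y).1, (0 : G)) = Θ y := by rw [← h0]
    simpa only [mem_ofPred, this] using Θ.map_source hy
  map_target' z hz := by
    have h1 := Θ.map_target hz
    have h2 : Θ.symm (z, 0) ∈ S := (hΘ.mem_iff _ h1).2 (by rw [Θ.right_inv hz])
    simpa [h2] using h1
  left_inv' y hy := by
    have h0 := (hΘ.mem_iff y hy).1 y.2
    have h1 : ((Θ y).1, (0 : G)) = Θ y := by rw [← h0]
    have h2 : Θ.symm ((Θ y).1, 0) = y := by rw [h1, Θ.left_inv hy]
    simp [h2]
  right_inv' z hz := by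
    have h1 := Θ.map_target hz
    have h2 : Θ.symm (z, 0) ∈ S := (hΘ.mem_iff _ h1).2 (by rw [Θ.right_inv hz])
    simp [h2, Θ.right_inv hz]
  open_source := Θ.open_source.preimage continuous_subtype_val
  open_target := Θ.open_target.preimage (by fun_prop : Continuous fun z : E' ↦ (z, (0 : G)))
  continuousOn_toFun := continuous_fst.comp_continuousOn
    (Θ.continuousOn.comp continuous_subtype_val.continuousOn fun _ h ↦ h)
  continuousOn_invFun := by
    rw [Topology.IsInducing.subtypeVal.continuousOn_iff]
    have : ContinuousOn (fun z : E' ↦ Θ.symm (z, (0 : G))) {z | (z, 0) ∈ Θ.target} :=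
      Θ.continuousOn_symm.comp (by fun_prop) fun _ h ↦ h
    refine this.congr fun z hz ↦ ?_
    have h2 : Θ.symm (z, 0) ∈ S := (hΘ.mem_iff _ (Θ.map_target hz)).2 (by rw [Θ.right_inv hz])
    simp [h2]

lemma IsSliceChart.coe_chart_symm {S : Set M} {Θ : OpenPartialHomeomorph M (E' × G)}
    (hΘ : IsSliceChart I S Θ) (x : S) {z : E'} (hz : z ∈ (hΘ.chart x).target) :
    ((hΘ.chart x).symm z : M) = Θ.symm (z, 0) := by
  have hz' : (z, (0 : G)) ∈ Θ.target := hz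
  have h2 : Θ.symm (z, 0) ∈ S := (hΘ.mem_iff _ (Θ.map_target hz')).2 (by rw [Θ.right_inv hz'])
  classical
  change ((if h : Θ.symm (z, 0) ∈ S then (⟨Θ.symm (z, 0), h⟩ : S) else x : S) : M) = _
  rw [dif_pos h2]

/-- A subset that has a slice chart around each of its points is an embedded submanifold. -/
theorem exists_isSmoothEmbedding_of_isSliceChart [IsManifold I ∞ M] [I.Boundaryless] {S : Set M}
    (hS : ∀ x ∈ S, ∃ Θ : OpenPartialHomeomorph M (E' × G), x ∈ Θ.source ∧ IsSliceChart I S Θ)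
    (hL : S.Nonempty → Nonempty ((E' × G) ≃L[ℝ] E)) :
    ∃ (_ : ChartedSpace E' S) (_ : IsManifold 𝓘(ℝ, E') ∞ S),
      Manifold.IsSmoothEmbedding 𝓘(ℝ, E') I ∞ (Subtype.val : S → M) := by
  choose Θ hmem hΘ using fun x : S ↦ hS x x.2
  let c (x : S) : OpenPartialHomeomorph S E' := (hΘ x).chart x
  let cs : ChartedSpace E' S :=
    { atlas := range c
      chartAt := c
      mem_chart_source := fun x ↦ hmem x
      chart_mem_atlas := fun x ↦ mem_range_self x }
  have hman : IsManifold 𝓘(ℝ, E') ∞ S := by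
    refine isManifold_of_contDiffOn _ _ _ ?_
    rintro _ _ ⟨x, rfl⟩ ⟨x', rfl⟩
    simp only [modelWithCornersSelf_coe, modelWithCornersSelf_coe_symm, Function.comp_id,
      Function.id_comp, preimage_id, range_id, inter_univ]
    rw [← contMDiffOn_iff_contDiffOn]
    have h1 : ContMDiffOn 𝓘(ℝ, E') I ∞ (fun z ↦ (Θ x).symm (z, (0 : G))) (c x).target :=
      (hΘ x).contMDiffOn_symm.comp
        (contDiff_prodMk_left (0 : G)).contMDiff.contMDiffOn fun z hz ↦ hz
    have h2 : ContMDiffOn 𝓘(ℝ, E') 𝓘(ℝ, E' × G) ∞ (fun z ↦ Θ x' ((Θ x).symm (z, (0 : G))))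
        ((c x).symm.trans (c x')).source := by
      refine (hΘ x').contMDiffOn.comp (h1.mono ?_) ?_
      · intro z hz
        exact hz.1
      · rintro z ⟨hz, hz'⟩
        have := (hΘ x).coe_chart_symm x hz
        rw [mem_preimage, ← this]
        exact hz'
    refine (contDiff_fst.contMDiff.comp_contMDiffOn h2).congr ?_
    rintro z ⟨hz, hz'⟩
    have := (hΘ x).coe_chart_symm x hz
    change (Θ x' ((c x).symm z : S)).1 = _
    rw [this]
    rfl
  refine ⟨cs, hman, ?_, Topology.IsEmbedding.subtypeVal⟩
  refine Manifold.IsImmersionOfComplement.isImmersion (F := G) fun x ↦ ?_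
  obtain ⟨L⟩ := hL ⟨x, x.2⟩
  let ψ : OpenPartialHomeomorph M H := (Θ x).trans
    (L.toHomeomorph.trans I.toHomeomorph.symm).toOpenPartialHomeomorph
  refine Manifold.IsImmersionAtOfComplement.mk_of_charts L (chartAt E' x) ψ (mem_chart_source E' x)
    (by simpa [ψ] using hmem x) (IsManifold.chart_mem_maximalAtlas x) ?_ ?_ ?_
  · apply OpenPartialHomeomorph.mem_maximalAtlas_of_contMDiffOn
    · have h1 : ContMDiffOn 𝓘(ℝ, E) I ∞ I.symm univ := by
        simpa [I.range_eq_univ] using I.contMDiffOn_symm (n := ∞)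
      have h2 : ContMDiffOn I 𝓘(ℝ, E) ∞ (fun y ↦ L (Θ x y)) (Θ x).source :=
        L.contDiff.contMDiff.comp_contMDiffOn (hΘ x).contMDiffOn
      refine (h1.comp h2 fun _ _ ↦ mem_univ _).mono ?_
      intro y hy
      simpa [ψ] using hy
    · have h1 : ContMDiffOn I I ∞ (fun w ↦ (Θ x).symm (L.symm (I w))) ψ.target :=
        (hΘ x).contMDiffOn_symm.comp
          ((L.symm.contDiff.contMDiff.comp I.contMDiff).contMDiffOn) fun w hw ↦ hw.2
      exact h1
  · intro y hy
    have : (y : M) ∈ (Θ x).source := hy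
    simpa [ψ] using this
  · intro z hz
    have hz' : z ∈ (c x).target := by
      simp only [mfld_simps] at hz
      exact hz
    have h1 := (hΘ x).coe_chart_symm x hz'
    have h2 : (z, (0 : G)) ∈ (Θ x).target := hz'
    change I (I.symm (L (Θ x ((c x).symm z : S)))) = L (z, 0)
    rw [h1, (Θ x).right_inv h2, I.right_inv (by simp [I.range_eq_univ])]

end Slices

/-! ### Normed cones and their unit spheres -/

section Pairing

variable {E : Type*} [NormedAddCommGroup E] [NormedSpace ℝ E]
  {H : Type*} [TopologicalSpace H] {I : ModelWithCorners ℝ E H}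
  {M : Type*} [TopologicalSpace M] [ChartedSpace H M]
  {P : TwoTensorField I M} {f g h : M → ℝ} {x : M}

lemma IsTwoVector.apply_comm (hP : IsTwoVector P) (x : M) (α β : TangentSpace I x →L[ℝ] ℝ) :
    β (P x α) = -α (P x β) := by
  have h1 := hP.skew x (α + β)
  have h2 := hP.skew x α
  have h3 := hP.skew x β
  simp only [map_add, add_apply] at h1
  linarith

lemma IsTwoVector.pairing_comm (hP : IsTwoVector P) (f g : M → ℝ) (x : M) :
    pairing P f g x = -pairing P g f x :=
  hP.apply_comm x _ _

lemma pairing_mul_left (hf : MDiffAt f x) (hg : MDiffAt g x) :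
    pairing P (fun y ↦ f y * g y) h x = f x * pairing P g h x + g x * pairing P f h x := by
  simp only [pairing, mvfderiv_fun_mul hf hg, map_add, map_smul, smul_eq_mul]

lemma pairing_neg_left : pairing P (fun y ↦ -f y) h x = -pairing P f h x := by
  simp only [pairing, mvfderiv_fun_neg, map_neg]

end Pairing

section Cone

variable {E E' : Type*} [NormedAddCommGroup E] [NormedSpace ℝ E]
  [NormedAddCommGroup E'] [NormedSpace ℝ E']
  {H H' : Type*} [TopologicalSpace H] [TopologicalSpace H']
  {I : ModelWithCorners ℝ E H} {J : ModelWithCorners ℝ E' H'}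
  {M : Type*} [TopologicalSpace M] [ChartedSpace H M]

variable (I) in
/-- A smooth action `μ` of the multiplicative monoid `ℝ` on `M`, together with an open cone `O` for
it, on which there is a smooth positive function `ρ`, homogeneous of degree one. -/
structure IsNormedCone (μ : ℝ → M → M) (O : Set M) (ρ : M → ℝ) : Prop where
  isOpen : IsOpen O
  contMDiff_smul : ContMDiff (𝓘(ℝ, ℝ).prod I) I ∞ (fun p : ℝ × M ↦ μ p.1 p.2)
  one_smul : ∀ x, μ 1 x = x
  smul_smul : ∀ s t x, μ s (μ t x) = μ (s * t) x
  smul_mem : ∀ t > 0, ∀ x ∈ O, μ t x ∈ O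
  pos : ∀ x ∈ O, 0 < ρ x
  contMDiffOn : CMDiff[O] ∞ ρ
  map_smul : ∀ t > 0, ∀ x ∈ O, ρ (μ t x) = t * ρ x

variable (I) in
/-- The generator `d/dt|_{t = 0} (1 + t) x` of the dilations. -/
def radialField (μ : ℝ → M → M) (x : M) : TangentSpace I x :=
  mfderiv 𝓘(ℝ, ℝ) I (fun t : ℝ ↦ μ (1 + t) x) 0 (1 : ℝ)

/-- A bivector field that the dilations scale with weight `-1`. -/
def IsHomogeneous (P : TwoTensorField I M) (μ : ℝ → M → M) (O : Set M) : Prop :=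
  ∀ t > 0, ∀ x ∈ O, ∀ β γ : TangentSpace I (μ t x) →L[ℝ] ℝ,
    t * γ (P (μ t x) β)
      = (γ ∘L mfderiv I I (μ t) x) (P x (β ∘L mfderiv I I (μ t) x))

variable {μ : ℝ → M → M} {O : Set M} {ρ : M → ℝ} {S : Set M}

namespace IsNormedCone

lemma contMDiff_smul_const (hμ : IsNormedCone I μ O ρ) (t : ℝ) : ContMDiff I I ∞ (μ t) :=
  hμ.contMDiff_smul.comp (contMDiff_const.prodMk contMDiff_id)

lemma contMDiff_smul_left (hμ : IsNormedCone I μ O ρ) (x : M) :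
    ContMDiff 𝓘(ℝ, ℝ) I ∞ (fun t ↦ μ t x) :=
  hμ.contMDiff_smul.comp (contMDiff_id.prodMk contMDiff_const)

/-- The bracket of homogeneous functions is homogeneous, its degree being the sum of the degrees
minus one. -/
lemma pairing_smul (hμ : IsNormedCone I μ O ρ) {P : TwoTensorField I M}
    (hP : IsHomogeneous P μ O) {a b : M → ℝ} (ha : CMDiff[O] ∞ a) (hb : CMDiff[O] ∞ b)
    {t c d : ℝ} (ht : 0 < t) (hac : ∀ x ∈ O, a (μ t x) = c * a x)
    (hbd : ∀ x ∈ O, b (μ t x) = d * b x) {x : M} (hx : x ∈ O) :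
    t * pairing P a b (μ t x) = c * d * pairing P a b x := by
  have key {a : M → ℝ} (ha : CMDiff[O] ∞ a) {c : ℝ} (hac : ∀ x ∈ O, a (μ t x) = c * a x) :
      mvfderiv I a (μ t x) ∘L mfderiv I I (μ t) x = c • mvfderiv I a x := by
    have h1 : mvfderiv I (a ∘ μ t) x = mvfderiv I (fun y ↦ c * a y) x :=
      mvfderiv_congr (Filter.eventuallyEq_of_mem (hμ.isOpen.mem_nhds hx) hac)
    have h2 : mvfderiv I (a ∘ μ t) x = mvfderiv I a (μ t x) ∘L mfderiv I I (μ t) x :=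
      mvfderiv_comp x ((ha.contMDiffAt
        (hμ.isOpen.mem_nhds (hμ.smul_mem t ht x hx))).mdifferentiableAt (by simp))
        ((hμ.contMDiff_smul_const t).mdifferentiable (by simp) x)
    have h3 : mvfderiv I (fun y ↦ c * a y) x = c • mvfderiv I a x := by
      rw [mvfderiv_fun_mul mdifferentiableAt_const
        ((ha.contMDiffAt (hμ.isOpen.mem_nhds hx)).mdifferentiableAt (by simp)), mvfderiv_const]
      simp
    rw [← h2, h1, h3]
  rw [pairing, hP t ht x hx, key ha hac, key hb hbd]
  simp [pairing]
  ring

open Classical in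
/-- The radial retraction of the cone onto its unit sphere `S`; the point `y₀` is a default value
outside the cone. -/
def retraction (hμ : IsNormedCone I μ O ρ) (hS : ∀ x, x ∈ S ↔ x ∈ O ∧ ρ x = 1) (y₀ : S) (x : M) :
    S :=
  if h : x ∈ O then
    ⟨μ (ρ x)⁻¹ x, (hS _).2 ⟨hμ.smul_mem _ (inv_pos.2 (hμ.pos x h)) x h, by
      rw [hμ.map_smul _ (inv_pos.2 (hμ.pos x h)) x h, inv_mul_cancel₀ (hμ.pos x h).ne']⟩⟩
  else y₀

lemma contMDiffOn_normalize (hμ : IsNormedCone I μ O ρ) :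
    ContMDiffOn I I ∞ (fun x ↦ μ (ρ x)⁻¹ x) O :=
  hμ.contMDiff_smul.comp_contMDiffOn ((hμ.contMDiffOn.inv₀ fun x hx ↦ (hμ.pos x hx).ne').prodMk
    contMDiffOn_id)

lemma mfderiv_smul_left (hμ : IsNormedCone I μ O ρ) (x : M) (s : ℝ) :
    (mfderiv 𝓘(ℝ, ℝ) I (fun t ↦ μ t x) 1 s : E) = (s • radialField I μ x : TangentSpace I x) := by
  have h0 : HasMFDerivAt 𝓘(ℝ, ℝ) 𝓘(ℝ, ℝ) (fun t : ℝ ↦ 1 + t) 0 (ContinuousLinearMap.id ℝ ℝ) :=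
    ((hasFDerivAt_id (0 : ℝ)).const_add 1).hasMFDerivAt
  have h1 := mfderiv_comp_apply_of_eq (f := fun t : ℝ ↦ 1 + t) (g := fun t ↦ μ t x)
    (x := (0 : ℝ)) (y := 1) (I := 𝓘(ℝ, ℝ)) (I' := 𝓘(ℝ, ℝ)) (I'' := I)
    ((hμ.contMDiff_smul_left x).mdifferentiable (by simp) 1) h0.mdifferentiableAt (by simp)
    (1 : ℝ)
  rw [h0.mfderiv] at h1
  have h2 : (radialField I μ x : E) = mfderiv 𝓘(ℝ, ℝ) I (fun t ↦ μ t x) 1 (1 : ℝ) := h1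
  have h3 := (mfderiv 𝓘(ℝ, ℝ) I (fun t ↦ μ t x) 1).map_smul s (1 : ℝ)
  have h4 : (s • (1 : ℝ) : ℝ) = s := by simp
  exact (congrArg (fun r : ℝ ↦ (mfderiv 𝓘(ℝ, ℝ) I (fun t ↦ μ t x) 1 r : E)) h4.symm).trans
    (h3.trans (congrArg (fun e : E ↦ s • e) h2.symm))

/-- At a point of the unit sphere, the differential of `x ↦ x / ρ x` is the projection along the
radial direction onto the kernel of `dρ`. -/
lemma mfderiv_normalize (hμ : IsNormedCone I μ O ρ) {y : M} (hy : y ∈ O) (h1 : ρ y = 1)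
    (w : TangentSpace I y) :
    (mfderiv I I (fun x ↦ μ (ρ x)⁻¹ x) y w : E)
      = (w - mvfderiv I ρ y w • radialField I μ y : TangentSpace I y) := by
  have hρ : MDiffAt ρ y :=
    (hμ.contMDiffOn.contMDiffAt (hμ.isOpen.mem_nhds hy)).mdifferentiableAt (by simp)
  have hρi : MDiffAt (fun x ↦ (ρ x)⁻¹) y :=
    ((hμ.contMDiffOn.inv₀ fun x hx ↦ (hμ.pos x hx).ne').contMDiffAt
      (hμ.isOpen.mem_nhds hy)).mdifferentiableAt (by simp)
  have hinv : mvfderiv I (fun x ↦ (ρ x)⁻¹) y = -mvfderiv I ρ y := by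
    have e1 : mvfderiv I (fun x ↦ (ρ x)⁻¹ * ρ x) y = mvfderiv I (fun _ ↦ (1 : ℝ)) y :=
      mvfderiv_congr (Filter.eventuallyEq_of_mem (hμ.isOpen.mem_nhds hy) fun x hx ↦
        inv_mul_cancel₀ (hμ.pos x hx).ne')
    rw [mvfderiv_fun_mul hρi hρ, mvfderiv_const, h1] at e1
    simpa using eq_neg_of_add_eq_zero_right e1
  have hμd : MDifferentiableAt (𝓘(ℝ, ℝ).prod I) I (fun p : ℝ × M ↦ μ p.1 p.2) (1, y) :=
    hμ.contMDiff_smul.mdifferentiable (by simp) _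
  have h2 := mfderiv_comp_apply_of_eq (f := fun x ↦ ((ρ x)⁻¹, x))
    (g := fun p : ℝ × M ↦ μ p.1 p.2) (x := y) (y := (1, y)) (I := I)
    (I' := 𝓘(ℝ, ℝ).prod I) (I'' := I) hμd (hρi.prodMk mdifferentiableAt_id) (by simp [h1]) w
  have hid : MDifferentiableAt I I (fun x : M ↦ x) y := mdifferentiableAt_id
  have h3 : (mfderiv I (𝓘(ℝ, ℝ).prod I) (fun x ↦ ((ρ x)⁻¹, x)) y w : ℝ × E)
      = (-(mvfderiv I ρ y w), w) := by
    refine (congrArg (fun T : E →L[ℝ] ℝ × E ↦ T w) (mfderiv_prodMk hρi hid)).trans ?_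
    refine Prod.ext ?_ ?_
    · exact congrArg (fun T : E →L[ℝ] ℝ ↦ T w) hinv
    · exact congrArg (fun T : E →L[ℝ] E ↦ T w) (mfderiv_id (I := I) (x := y))
  let Δ : E := radialField I μ y
  have h4 (v : ℝ × E) : (mfderiv (𝓘(ℝ, ℝ).prod I) I (fun p : ℝ × M ↦ μ p.1 p.2) (1, y) v : E)
      = v.1 • Δ + v.2 := by
    refine (mfderiv_prod_eq_add_apply (p := (1, y)) (v := v) hμd).trans ?_
    have e1 := hμ.mfderiv_smul_left y v.1
    have e2 : (mfderiv I I (μ 1) y v.2 : E) = v.2 := by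
      have : μ 1 = id := funext hμ.one_smul
      rw [this, mfderiv_id]
      rfl
    exact congrArg₂ (fun a b : E ↦ a + b) e1 e2
  refine h2.trans ((h4 _).trans ?_)
  refine (congrArg (fun v : ℝ × E ↦ v.1 • Δ + v.2) h3).trans ?_
  have h5 (a : ℝ) (u : E) : -a • Δ + u = u - a • Δ := by
    rw [neg_smul, neg_add_eq_sub]
  exact h5 _ _

variable (hμ : IsNormedCone I μ O ρ) (hS : ∀ x, x ∈ S ↔ x ∈ O ∧ ρ x = 1) (y₀ : S)

lemma coe_retraction {x : M} (hx : x ∈ O) : (hμ.retraction hS y₀ x : M) = μ (ρ x)⁻¹ x := by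
  rw [retraction, dif_pos hx]

lemma retraction_coe (y : S) : hμ.retraction hS y₀ y = y := by
  apply Subtype.ext
  rw [coe_retraction _ _ _ ((hS y).1 y.2).1, ((hS y).1 y.2).2, inv_one, hμ.one_smul]

lemma retraction_smul {x : M} (hx : x ∈ O) {t : ℝ} (ht : 0 < t) :
    hμ.retraction hS y₀ (μ t x) = hμ.retraction hS y₀ x := by
  apply Subtype.ext
  rw [coe_retraction _ _ _ (hμ.smul_mem t ht x hx), coe_retraction _ _ _ hx, hμ.map_smul t ht x hx,
    hμ.smul_smul]
  congr 1
  field_simp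

variable [ChartedSpace H' S]

lemma contMDiffOn_retraction (hι : Manifold.IsSmoothEmbedding J I ∞ (Subtype.val : S → M)) :
    ContMDiffOn I J ∞ (hμ.retraction hS y₀) O := by
  have h1 : ContMDiffOn I I ∞ (fun x ↦ (hμ.retraction hS y₀ x : M)) O :=
    hμ.contMDiffOn_normalize.congr fun x hx ↦ coe_retraction hμ hS y₀ hx
  intro x hx
  have h2 := h1.contMDiffAt (hμ.isOpen.mem_nhds hx)
  refine ContMDiffAt.contMDiffWithinAt ?_
  rw [ContMDiffAt.iff_comp_isImmersionAt (hι.isImmersion.isImmersionAt _)]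
  exact ⟨Topology.IsInducing.subtypeVal.continuousAt_iff.2 h2.continuousAt, h2⟩

/-- The differential of the radial retraction at a point of the unit sphere, as a map with values in
the tangent space of the sphere. -/
lemma exists_mfderiv_retraction (hι : Manifold.IsSmoothEmbedding J I ∞ (Subtype.val : S → M))
    (y : S) : ∃ T : TangentSpace I (y : M) →L[ℝ] TangentSpace J y,
      (∀ f : S → ℝ, MDiffAt f y →
        mvfderiv I (f ∘ hμ.retraction hS y₀) (y : M) = mvfderiv J f y ∘L T) ∧
      ∀ w, mfderiv J I (Subtype.val : S → M) y (T w)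
        = w - mvfderiv I ρ (y : M) w • radialField I μ (y : M) := by
  obtain ⟨hy, hy1⟩ := (hS y).1 y.2
  have hr : MDifferentiableAt I J (hμ.retraction hS y₀) (y : M) :=
    ((contMDiffOn_retraction hμ hS y₀ hι).contMDiffAt (hμ.isOpen.mem_nhds hy)).mdifferentiableAt
      (by simp)
  have hval : MDifferentiable J I (Subtype.val : S → M) := hι.contMDiff.mdifferentiable (by simp)
  have hry : hμ.retraction hS y₀ y = y := retraction_coe hμ hS y₀ y
  refine ⟨mfderiv I J (hμ.retraction hS y₀) (y : M), fun f hf ↦ ?_, fun w ↦ ?_⟩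
  · ext w
    exact mvfderiv_comp_apply_of_eq _ hf hr hry w
  · have h1 := mfderiv_comp_apply_of_eq _ (hval y) hr hry w
    have h2 : mfderiv I I (Subtype.val ∘ hμ.retraction hS y₀) (y : M)
        = mfderiv I I (fun x ↦ μ (ρ x)⁻¹ x) (y : M) :=
      Filter.EventuallyEq.mfderiv_eq (Filter.eventuallyEq_of_mem (hμ.isOpen.mem_nhds hy) fun x hx ↦
        coe_retraction hμ hS y₀ hx)
    have h3 := congrArg (fun T : E →L[ℝ] E ↦ T w) h2
    exact h1.symm.trans (h3.trans (hμ.mfderiv_normalize hy hy1 w))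

/-- The tangent spaces of the unit sphere are the kernels of `dρ`. -/
lemma range_mfderiv_coe (hμ : IsNormedCone I μ O ρ) (hS : ∀ x, x ∈ S ↔ x ∈ O ∧ ρ x = 1)
    (hι : Manifold.IsSmoothEmbedding J I ∞ (Subtype.val : S → M)) (y : S) :
    (mfderiv J I (Subtype.val : S → M) y).range = (mvfderiv I ρ (y : M)).ker := by
  obtain ⟨hy, hy1⟩ := (hS y).1 y.2
  ext w
  constructor
  · rintro ⟨v, rfl⟩
    have hρ : MDiffAt ρ (y : M) :=
      (hμ.contMDiffOn.contMDiffAt (hμ.isOpen.mem_nhds hy)).mdifferentiableAt (by simp)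
    have h1 := mvfderiv_comp_apply y hρ (hι.contMDiff.mdifferentiable (by simp) y) v
    have h2 : ρ ∘ (Subtype.val : S → M) = fun _ ↦ 1 := funext fun z ↦ ((hS z).1 z.2).2
    rw [h2, mvfderiv_const] at h1
    exact h1.symm
  · intro hw
    obtain ⟨T, -, hT⟩ := exists_mfderiv_retraction hμ hS y hι y
    have hw' : mvfderiv I ρ (y : M) w = 0 := hw
    refine ⟨T w, (hT w).trans ?_⟩
    rw [hw', zero_smul, sub_zero]

end IsNormedCone

end Cone

/-! ### The Jacobi structure on the unit sphere of a cone -/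

section ConeJacobi

variable {E E' : Type*} [NormedAddCommGroup E] [NormedSpace ℝ E] [FiniteDimensional ℝ E]
  [NormedAddCommGroup E'] [NormedSpace ℝ E'] [FiniteDimensional ℝ E']
  {H H' : Type*} [TopologicalSpace H] [TopologicalSpace H']
  {I : ModelWithCorners ℝ E H} {J : ModelWithCorners ℝ E' H'}
  {M : Type*} [TopologicalSpace M] [ChartedSpace H M] [T2Space M] [IsManifold I ∞ M]
  {μ : ℝ → M → M} {O : Set M} {ρ : M → ℝ} {S : Set M} [ChartedSpace H' S] [IsManifold J ∞ S]

/-- If the brackets of functions on the unit sphere of a normed cone, and the derivatives along `R`,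
are computed from the radial extensions of degree zero, then the Jacobi identity of the homogeneous
Poisson structure makes `(Λ, R)` a Jacobi structure. -/
lemma isJacobi_of_retraction (hμ : IsNormedCone I μ O ρ) (hS : ∀ x, x ∈ S ↔ x ∈ O ∧ ρ x = 1)
    (hι : Manifold.IsSmoothEmbedding J I ∞ (Subtype.val : S → M))
    {P : TwoTensorField I M} (hP : IsPoisson P) (hH : IsHomogeneous P μ O) (y₀ : S)
    {Λ : TwoTensorField J S} {R : (y : S) → TangentSpace J y}
    (hskew : ∀ (y : S) (α : TangentSpace J y →L[ℝ] ℝ), α (Λ y α) = 0)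
    (hΛ : ∀ f g : S → ℝ, CMDiff ∞ f → CMDiff ∞ g → ∀ y : S, pairing Λ f g y
      = pairing P (f ∘ hμ.retraction hS y₀) (g ∘ hμ.retraction hS y₀) y)
    (hR : ∀ f : S → ℝ, CMDiff ∞ f → ∀ y : S,
      derivAlong R f y = pairing P ρ (f ∘ hμ.retraction hS y₀) y) :
    IsJacobi Λ R := by
  set r := hμ.retraction hS y₀ with hr
  have hO := hμ.isOpen
  have hSO (y : S) : (y : M) ∈ O := ((hS y).1 y.2).1
  have hρ1 (y : S) : ρ y = 1 := ((hS y).1 y.2).2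
  have hι' : ContMDiff J I ∞ (Subtype.val : S → M) := hι.contMDiff
  have hrs : ContMDiffOn I J ∞ r O := hμ.contMDiffOn_retraction hS y₀ hι
  have ext {f : S → ℝ} (hf : CMDiff ∞ f) : CMDiff[O] ∞ (f ∘ r) := hf.comp_contMDiffOn hrs
  have hinv (f : S → ℝ) {t : ℝ} (ht : 0 < t) (x : M) (hx : x ∈ O) :
      (f ∘ r) (μ t x) = 1 * (f ∘ r) x := by
    rw [one_mul, Function.comp_apply, hr, hμ.retraction_smul hS y₀ hx ht]
    rfl
  have sm {a b : M → ℝ} (ha : CMDiff[O] ∞ a) (hb : CMDiff[O] ∞ b) : CMDiff[O] ∞ (pairing P a b) :=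
    hP.contMDiffOn_pairing hO ha hb
  have md {a : M → ℝ} (ha : CMDiff[O] ∞ a) (y : S) : MDiffAt a (y : M) :=
    (ha.contMDiffAt (hO.mem_nhds (hSO y))).mdifferentiableAt (by simp)
  have res {a : M → ℝ} (ha : CMDiff[O] ∞ a) : CMDiff ∞ (fun y : S ↦ a y) := fun y ↦
    (ha.contMDiffAt (hO.mem_nhds (hSO y))).comp y hι'.contMDiffAt
  have hΛs {f g : S → ℝ} (hf : CMDiff ∞ f) (hg : CMDiff ∞ g) : CMDiff ∞ (pairing Λ f g) := by
    rw [funext (hΛ f g hf hg)]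
    exact res (sm (ext hf) (ext hg))
  have hRs {f : S → ℝ} (hf : CMDiff ∞ f) : CMDiff ∞ (derivAlong R f) := by
    rw [funext (hR f hf)]
    exact res (sm hμ.contMDiffOn (ext hf))
  -- The bracket of two functions of degree zero has degree `-1`, so its restriction to the sphere
  -- extends to `ρ` times the bracket.
  have hΛr {f g : S → ℝ} (hf : CMDiff ∞ f) (hg : CMDiff ∞ g) (x : M) (hx : x ∈ O) :
      (pairing Λ f g ∘ r) x = ρ x * pairing P (f ∘ r) (g ∘ r) x := by
    have ht : 0 < (ρ x)⁻¹ := inv_pos.2 (hμ.pos x hx)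
    have := hμ.pairing_smul hH (ext hf) (ext hg) ht (hinv f ht) (hinv g ht) hx
    rw [Function.comp_apply, hΛ f g hf hg, hr, hμ.coe_retraction hS y₀ hx, ← hr]
    rw [← mul_left_cancel_iff_of_pos ht, this, ← mul_assoc, inv_mul_cancel₀ (hμ.pos x hx).ne',
      one_mul, one_mul]
  have hRr {f : S → ℝ} (hf : CMDiff ∞ f) (x : M) (hx : x ∈ O) :
      (derivAlong R f ∘ r) x = pairing P ρ (f ∘ r) x := by
    have ht : 0 < (ρ x)⁻¹ := inv_pos.2 (hμ.pos x hx)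
    have := hμ.pairing_smul hH hμ.contMDiffOn (ext hf) ht (hμ.map_smul _ ht) (hinv f ht) hx
    rw [Function.comp_apply, hR f hf, hr, hμ.coe_retraction hS y₀ hx, ← hr]
    exact mul_left_cancel₀ ht.ne' (by linarith)
  have nh (y : S) := hO.mem_nhds (hSO y)
  have hΛΛ {f g k : S → ℝ} (hf : CMDiff ∞ f) (hg : CMDiff ∞ g) (hk : CMDiff ∞ k) (y : S) :
      pairing Λ (pairing Λ f g) k y = pairing P (pairing P (f ∘ r) (g ∘ r)) (k ∘ r) y
        + pairing Λ f g y * derivAlong R k y := by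
    rw [hΛ _ k (hΛs hf hg) hk, (pairing_congr (Filter.eventuallyEq_of_mem (nh y) (hΛr hf hg))
      (Filter.EventuallyEq.refl _ _)).eq_of_nhds, pairing_mul_left (md hμ.contMDiffOn y)
      (md (sm (ext hf) (ext hg)) y), hρ1, one_mul, hΛ f g hf hg, hR k hk]
  refine ⟨⟨hskew, fun f g hf hg ↦ hΛs hf hg⟩, contMDiff_of_derivAlong fun f hf ↦ hRs hf, ?_, ?_⟩
  · intro f g k hf hg hk y
    have hJ := hP.schouten_eq_zero_of_contMDiffOn hO (ext hf) (ext hg) (ext hk) (hSO y)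
    simp only [schouten, wedgeThree] at hJ ⊢
    rw [hΛΛ hf hg hk, hΛΛ hg hk hf, hΛΛ hk hf hg]
    linarith
  · intro f g hf hg y
    have hJ := hP.schouten_eq_zero_of_contMDiffOn hO (ext hf) (ext hg) hμ.contMDiffOn (hSO y)
    have hρρ : pairing P ρ ρ y = 0 := hP.skew _ _
    have h1 : derivAlong R (pairing Λ f g) y
        = -pairing P (pairing P (f ∘ r) (g ∘ r)) ρ y := by
      rw [hR _ (hΛs hf hg), hP.pairing_comm, (pairing_congr
        (Filter.eventuallyEq_of_mem (nh y) (hΛr hf hg)) (Filter.EventuallyEq.refl _ _)).eq_of_nhds,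
        pairing_mul_left (md hμ.contMDiffOn y) (md (sm (ext hf) (ext hg)) y), hρ1, hρρ]
      ring
    have h2 : pairing Λ (derivAlong R f) g y = pairing P (pairing P ρ (f ∘ r)) (g ∘ r) y := by
      rw [hΛ _ g (hRs hf) hg]
      exact (pairing_congr (Filter.eventuallyEq_of_mem (nh y) (hRr hf))
        (Filter.EventuallyEq.refl _ _)).eq_of_nhds
    have h3 : pairing Λ f (derivAlong R g) y = pairing P (pairing P (g ∘ r) ρ) (f ∘ r) y := by
      have e : pairing P (g ∘ r) ρ = fun x ↦ -pairing P ρ (g ∘ r) x := funext (hP.pairing_comm _ _)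
      rw [hΛ f _ hf (hRs hg), hP.pairing_comm, e, pairing_neg_left]
      congr 1
      exact (pairing_congr (Filter.eventuallyEq_of_mem (nh y) (hRr hg))
        (Filter.EventuallyEq.refl _ _)).eq_of_nhds
    simp only [schouten] at hJ
    rw [lieDerivative, h1, h2, h3]
    linarith

/-- The unit sphere of a normed cone with a homogeneous Poisson structure is a Jacobi manifold. Its
structure is the image of the Poisson structure under the radial retraction. -/
theorem IsNormedCone.exists_isJacobi (hμ : IsNormedCone I μ O ρ)
    (hS : ∀ x, x ∈ S ↔ x ∈ O ∧ ρ x = 1)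
    (hι : Manifold.IsSmoothEmbedding J I ∞ (Subtype.val : S → M))
    {P : TwoTensorField I M} (hP : IsPoisson P) (hH : IsHomogeneous P μ O) :
    ∃ (Λ : TwoTensorField J S) (R : (y : S) → TangentSpace J y), IsJacobi Λ R ∧
      (∀ (y : S) (β : TangentSpace I (y : M) →L[ℝ] ℝ),
        mfderiv J I (Subtype.val : S → M) y (Λ y (β ∘L mfderiv J I (Subtype.val : S → M) y))
          = (P y + wedge (radialField I μ (y : M)) (hamiltonianField P ρ y)) β) ∧
      ∀ y : S, mfderiv J I (Subtype.val : S → M) y (R y) = -hamiltonianField P ρ (y : M) := by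
  rcases isEmpty_or_nonempty S with hE | ⟨⟨y₀⟩⟩
  · exact ⟨fun _ ↦ 0, fun _ ↦ 0, ⟨⟨isEmptyElim, fun _ _ _ _ ↦ isEmptyElim⟩, isEmptyElim,
      fun _ _ _ _ _ _ ↦ isEmptyElim, fun _ _ _ _ ↦ isEmptyElim⟩, isEmptyElim, isEmptyElim⟩
  choose T hTf hTι using hμ.exists_mfderiv_retraction hS y₀ hι
  let Λ : TwoTensorField J S := fun y ↦
    { toFun γ := T y (P y (γ ∘L T y))
      map_add' γ γ' := by
        have : (γ + γ') ∘L T y = γ ∘L T y + γ' ∘L T y := by ext; simp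
        rw [this, map_add, map_add]
      map_smul' c γ := by
        have : (c • γ) ∘L T y = c • (γ ∘L T y) := by ext; simp
        rw [this, _root_.map_smul, _root_.map_smul, RingHom.id_apply] }
  let R : (y : S) → TangentSpace J y := fun y ↦ T y (P y (mvfderiv I ρ (y : M)))
  refine ⟨Λ, R, isJacobi_of_retraction hμ hS hι hP hH y₀ ?_ ?_ ?_, ?_, ?_⟩
  · intro y α
    exact hP.skew y (α ∘L T y)
  · intro f g hf hg y
    simp only [pairing, hTf y f (hf.mdifferentiable (by simp) y),
      hTf y g (hg.mdifferentiable (by simp) y)]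
    rfl
  · intro f hf y
    simp only [pairing, hTf y f (hf.mdifferentiable (by simp) y)]
    rfl
  · intro y β
    set dρ := mvfderiv I ρ (y : M) with hdρ
    set Δ := radialField I μ (y : M)
    have h1 : (β ∘L mfderiv J I (Subtype.val : S → M) y) ∘L T y = β - β Δ • dρ := by
      ext w
      have := congrArg β (hTι y w)
      simp only [map_sub, _root_.map_smul, smul_eq_mul] at this
      simp only [ContinuousLinearMap.comp_apply, sub_apply, smul_apply, smul_eq_mul]
      rw [this, mul_comm]
    have h2 : Λ y (β ∘L mfderiv J I (Subtype.val : S → M) y) = T y (P y (β - β Δ • dρ)) := by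
      rw [← h1]
      rfl
    rw [h2, hTι, map_sub, _root_.map_smul]
    have h3 : dρ (P y dρ) = 0 := hP.skew _ _
    have h4 := hP.apply_comm y β dρ
    simp only [map_sub, _root_.map_smul, h3, h4, smul_zero, sub_zero, neg_smul, sub_neg_eq_add,
      LinearMap.add_apply, wedge, hamiltonianField, LinearMap.coe_mk, AddHom.coe_mk, map_neg,
      smul_neg, ← hdρ]
    abel
  · intro y
    have h3 : mvfderiv I ρ (y : M) (P y (mvfderiv I ρ (y : M))) = 0 := hP.skew _ _
    refine (hTι y _).trans ?_
    rw [h3, zero_smul, sub_zero, hamiltonianField, neg_neg]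

end ConeJacobi

/-! ### Integral curves of proportional vector fields -/

section Trajectories

variable {E : Type*} [NormedAddCommGroup E] [NormedSpace ℝ E]
  {H : Type*} [TopologicalSpace H] {I : ModelWithCorners ℝ E H}
  {M : Type*} [TopologicalSpace M] [ChartedSpace H M]
  {X Y : (x : M) → TangentSpace I x} {W S : Set M} {σ : M → ℝ} {c ce : ℝ → M} {J Je : Set ℝ}

/-- A function whose differential annihilates the velocity is constant along an integral curve. -/
lemma eq_of_isMIntegralCurveOn {f : M → ℝ} (hJ : IsOpen J) (hJc : J.OrdConnected)
    (hc : IsMIntegralCurveOn c X J) (hf : ∀ s ∈ J, MDiffAt f (c s))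
    (hX : ∀ s ∈ J, mvfderiv I f (c s) (X (c s)) = 0) {s t : ℝ} (hs : s ∈ J) (ht : t ∈ J) :
    f (c s) = f (c t) := by
  have key (u : ℝ) (hu : u ∈ J) : HasDerivAt (f ∘ c) 0 u := by
    have h1 : HasMFDerivAt 𝓘(ℝ, ℝ) 𝓘(ℝ, ℝ) (f ∘ c) u _ :=
      (hf u hu).hasMFDerivAt.comp u ((hc u hu).hasMFDerivAt (hJ.mem_nhds hu))
    let T : ℝ →L[ℝ] ℝ := mvfderiv I f (c u) ∘L (1 : ℝ →L[ℝ] ℝ).smulRight (X (c u))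
    have hT : HasFDerivAt (f ∘ c) T u := hasMFDerivAt_iff_hasFDerivAt.1 h1
    have h2 : HasDerivAt (f ∘ c) (mvfderiv I f (c u) ((1 : ℝ) • X (c u))) u := hT.hasDerivAt
    rwa [one_smul, hX u hu] at h2
  exact hJ.eqOn_of_deriv_eq (f := f ∘ c) (g := fun _ ↦ f (c t)) hJc.isPreconnected
    (fun u hu ↦ (key u hu).differentiableAt.differentiableWithinAt) (differentiableOn_const _)
    (fun u hu ↦ by simp [(key u hu).deriv]) ht rfl hs

variable [T2Space M] [IsManifold I 1 M] [BoundarylessManifold I M]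

/-- Uniqueness of integral curves on an open interval, for a vector field that is only known to be
differentiable along one of the curves. -/
lemma eqOn_of_isMIntegralCurveOn {γ γ' : ℝ → M} {K : Set ℝ} (hK : IsOpen K) (hKc : K.OrdConnected)
    (hY : ∀ t ∈ K, ContMDiffAt I I.tangent 1 (fun x ↦ (⟨x, Y x⟩ : TangentBundle I M)) (γ t))
    (hγ : IsMIntegralCurveOn γ Y K) (hγ' : IsMIntegralCurveOn γ' Y K) {t₀ : ℝ} (ht₀ : t₀ ∈ K)
    (h : γ t₀ = γ' t₀) : EqOn γ γ' K := by
  set s := {t | γ t = γ' t} ∩ K with hs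
  suffices hsub : K ⊆ s from fun t ht ↦ (hsub ht).1
  have hcont {γ : ℝ → M} (hγ : IsMIntegralCurveOn γ Y K) : Continuous fun t : K ↦ γ t :=
    continuousOn_iff_continuous_domRestrict.1 hγ.continuousOn
  apply hKc.isPreconnected.subset_of_closure_inter_subset (u := s) _ ⟨t₀, ht₀, h, ht₀⟩
  · rw [hs, inter_comm, ← Subtype.image_preimage_val, inter_comm, ← Subtype.image_preimage_val,
      image_subset_image_iff Subtype.val_injective, preimage_ofPred_eq]
    intro t ht
    rw [mem_preimage, ← closure_subtype] at ht
    exact (isClosed_eq (hcont hγ) (hcont hγ')).closure_subset ht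
  · rw [isOpen_iff_mem_nhds]
    intro t₁ ht₁
    have hmem := hK.mem_nhds ht₁.2
    have heq : γ =ᶠ[𝓝 t₁] γ' := isMIntegralCurveAt_eventuallyEq_of_contMDiffAt_boundaryless
      (hY t₁ ht₁.2) (hγ.isMIntegralCurveAt hmem) (hγ'.isMIntegralCurveAt hmem) ht₁.1
    exact (heq.and hmem).mono fun _ ht ↦ ht

/-- If `X = σ Y` with `σ > 0` along `S`, trajectories of `X` and `Y` in `S` with the same origin
differ by the time change `h' = σ`. -/
theorem exists_reparametrization
    (hY : ∀ x ∈ S, ContMDiffAt I I.tangent 1 (fun x ↦ (⟨x, Y x⟩ : TangentBundle I M)) x)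
    (hσ : ContinuousOn σ S) (hσpos : ∀ x ∈ S, 0 < σ x) (hXY : ∀ x ∈ S, X x = σ x • Y x)
    (hc : IsTrajectory X W c J) (hce : IsTrajectory Y W ce Je) (hcS : MapsTo c J S)
    (h0 : ce 0 = c 0) :
    ∃ h : ℝ → ℝ, h 0 = 0 ∧ StrictMonoOn h J ∧
      (∀ s ∈ J, HasDerivAt h (σ (c s)) s) ∧
      (∀ s ∈ J, h s ∈ Je → c s = ce (h s)) ∧
      (IsMaximalTrajectory Y W ce Je → MapsTo h J Je) := by
  have hJ := hc.isOpen
  have hcont : ContinuousOn (fun s ↦ σ (c s)) J := hσ.comp hc.integral.continuousOn hcS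
  let h : ℝ → ℝ := fun s ↦ ∫ u in (0 : ℝ)..s, σ (c u)
  have hh0 : h 0 = 0 := intervalIntegral.integral_same
  have hstrict (s : ℝ) (hs : s ∈ J) : HasStrictDerivAt h (σ (c s)) s :=
    intervalIntegral.integral_hasStrictDerivAt_right
      ((hcont.mono (hc.ordConnected.uIcc_subset hc.zero_mem hs)).intervalIntegrable)
      (hcont.stronglyMeasurableAtFilter hJ s hs) (hcont.continuousAt (hJ.mem_nhds hs))
  have hpos (s : ℝ) (hs : s ∈ J) : 0 < σ (c s) := hσpos _ (hcS hs)
  have hmono : StrictMonoOn h J := by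
    refine strictMonoOn_of_deriv_pos hc.ordConnected.convex
      (fun s hs ↦ (hstrict s hs).hasDerivAt.continuousAt.continuousWithinAt) fun s hs ↦ ?_
    rw [(hstrict s (interior_subset hs)).hasDerivAt.deriv]
    exact hpos s (interior_subset hs)
  have himage (s : ℝ) (hs : s ∈ J) : h '' J ∈ 𝓝 (h s) := by
    rw [← (hstrict s hs).map_nhds_eq (hpos s hs).ne']
    exact Filter.image_mem_map (hJ.mem_nhds hs)
  have hK : IsOpen (h '' J) := isOpen_iff_mem_nhds.2 (by rintro _ ⟨s, hs, rfl⟩; exact himage s hs)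
  have hKc : (h '' J).OrdConnected :=
    (hc.ordConnected.isPreconnected.image h fun s hs ↦
      (hstrict s hs).hasDerivAt.continuousAt.continuousWithinAt).ordConnected
  -- the inverse time change
  let k := Function.invFunOn h J
  have hkJ {t : ℝ} (ht : t ∈ h '' J) : k t ∈ J := Function.invFunOn_mem ht
  have hhk {t : ℝ} (ht : t ∈ h '' J) : h (k t) = t := Function.invFunOn_eq ht
  have hkh {s : ℝ} (hs : s ∈ J) : k (h s) = s :=
    hmono.injOn (hkJ ⟨s, hs, rfl⟩) hs (hhk ⟨s, hs, rfl⟩)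
  have hkmono : StrictMonoOn k (h '' J) := by
    rintro _ ⟨a, ha, rfl⟩ _ ⟨b, hb, rfl⟩ hab
    rw [hkh ha, hkh hb]
    exact (hmono.lt_iff_lt ha hb).1 hab
  have hkderiv {t : ℝ} (ht : t ∈ h '' J) : HasDerivAt k (σ (c (k t)))⁻¹ t := by
    refine (hstrict _ (hkJ ht)).hasDerivAt.of_local_left_inverse ?_ (hpos _ (hkJ ht)).ne'
      (Filter.eventually_of_mem (hK.mem_nhds ht) fun y hy ↦ hhk hy)
    refine hkmono.continuousAt_of_image_mem_nhds (hK.mem_nhds ht) ?_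
    refine Filter.mem_of_superset (hJ.mem_nhds (hkJ ht)) fun s hs ↦ ⟨h s, ⟨s, hs, rfl⟩, hkh hs⟩
  have hd : IsMIntegralCurveOn (c ∘ k) Y (h '' J) := by
    intro t ht
    have h1 := ((hc.integral (k t) (hkJ ht)).hasMFDerivAt (hJ.mem_nhds (hkJ ht))).comp t
      (hkderiv ht).hasFDerivAt.hasMFDerivAt
    refine HasMFDerivAt.hasMFDerivWithinAt ?_
    refine h1.congr_mfderiv ?_
    have e1 : σ (c (k t)) ≠ 0 := (hpos _ (hkJ ht)).ne'
    have e2 : Y (c (k t)) = (σ (c (k t)))⁻¹ • X (c (k t)) := by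
      rw [hXY _ (hcS (hkJ ht)), smul_smul, inv_mul_cancel₀ e1, one_smul]
    refine ContinuousLinearMap.ext fun (v : ℝ) ↦ ?_
    change (v • (σ (c (k t)))⁻¹) • X (c (k t)) = v • Y (c (k t))
    rw [e2, smul_smul, smul_eq_mul]
  have hK0 : (0 : ℝ) ∈ h '' J := ⟨0, hc.zero_mem, hh0⟩
  have hk0 : k 0 = 0 := by simpa [hh0] using hkh hc.zero_mem
  have heq : EqOn (c ∘ k) ce (h '' J ∩ Je) :=
    eqOn_of_isMIntegralCurveOn (hK.inter hce.isOpen) (hKc.inter hce.ordConnected)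
      (fun t ht ↦ hY _ (hcS (hkJ ht.1))) (hd.mono inter_subset_left)
      (hce.integral.mono inter_subset_right) ⟨hK0, hce.zero_mem⟩
      (by rw [Function.comp_apply, hk0, h0])
  refine ⟨h, hh0, hmono, fun s hs ↦ (hstrict s hs).hasDerivAt, fun s hs hs' ↦ ?_, fun hmax ↦ ?_⟩
  · rw [← heq ⟨⟨s, hs, rfl⟩, hs'⟩, Function.comp_apply, hkh hs]
  · -- otherwise `ce` could be extended by `c ∘ k`
    classical
    let γ := Je.piecewise ce (c ∘ k)
    have h1 : EqOn γ ce Je := piecewise_eqOn _ _ _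
    have h2 : EqOn γ (c ∘ k) (h '' J) := by
      intro t ht
      by_cases ht' : t ∈ Je
      · rw [h1 ht', heq ⟨ht, ht'⟩]
      · exact piecewise_eq_of_notMem _ _ _ ht'
    have hγ : IsTrajectory Y W γ (Je ∪ h '' J) :=
      { isOpen := hce.isOpen.union hK
        ordConnected := (hce.ordConnected.isPreconnected.union 0 hce.zero_mem hK0
          hKc.isPreconnected).ordConnected
        zero_mem := Or.inl hce.zero_mem
        mapsTo := by
          rintro t (ht | ht)
          · rw [h1 ht]
            exact hce.mapsTo ht
          · rw [h2 ht]
            exact hc.mapsTo (hkJ ht)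
        integral := by
          rintro t (ht | ht)
          · refine HasMFDerivAt.hasMFDerivWithinAt ?_
            rw [h1 ht]
            exact ((hce.integral t ht).hasMFDerivAt (hce.isOpen.mem_nhds ht)).congr_of_eventuallyEq
              (Filter.eventuallyEq_of_mem (hce.isOpen.mem_nhds ht) h1)
          · refine HasMFDerivAt.hasMFDerivWithinAt ?_
            rw [h2 ht]
            exact ((hd t ht).hasMFDerivAt (hK.mem_nhds ht)).congr_of_eventuallyEq
              (Filter.eventuallyEq_of_mem (hK.mem_nhds ht) h2) }
    have h3 := hmax.maximal γ _ hγ subset_union_left h1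
    intro s hs
    rw [← h3]
    exact Or.inr ⟨s, hs, rfl⟩

/-- The time change between two maximal trajectories is onto: the time changes in the two directions
are inverse to each other. -/
theorem exists_reparametrization_bijOn
    (hX : ∀ x ∈ S, ContMDiffAt I I.tangent 1 (fun x ↦ (⟨x, X x⟩ : TangentBundle I M)) x)
    (hY : ∀ x ∈ S, ContMDiffAt I I.tangent 1 (fun x ↦ (⟨x, Y x⟩ : TangentBundle I M)) x)
    (hσ : ContinuousOn σ S) (hσpos : ∀ x ∈ S, 0 < σ x) (hXY : ∀ x ∈ S, X x = σ x • Y x)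
    (hc : IsTrajectory X W c J) (hce : IsTrajectory Y W ce Je) (hcS : MapsTo c J S)
    (hceS : MapsTo ce Je S) (h0 : ce 0 = c 0) :
    ∃ h : ℝ → ℝ, h 0 = 0 ∧ StrictMonoOn h J ∧
      (∀ s ∈ J, HasDerivAt h (σ (c s)) s) ∧
      (∀ s ∈ J, h s ∈ Je → c s = ce (h s)) ∧
      (IsMaximalTrajectory Y W ce Je → MapsTo h J Je) ∧
      (IsMaximalTrajectory Y W ce Je → IsMaximalTrajectory X W c J → BijOn h J Je) := by
  obtain ⟨h, hh0, hmono, hderiv, heq, hmaps⟩ :=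
    exists_reparametrization hY hσ hσpos hXY hc hce hcS h0
  refine ⟨h, hh0, hmono, hderiv, heq, hmaps, fun hmax hmax' ↦ ⟨hmaps hmax, hmono.injOn, ?_⟩⟩
  have hYX (x : M) (hx : x ∈ S) : Y x = (σ x)⁻¹ • X x := by
    rw [hXY x hx, smul_smul, inv_mul_cancel₀ (hσpos x hx).ne', one_smul]
  obtain ⟨k, hk0, -, hkderiv, hkeq, hkmaps⟩ :=
    exists_reparametrization (σ := fun x ↦ (σ x)⁻¹) hX (hσ.inv₀ fun x hx ↦ (hσpos x hx).ne')
      (fun x hx ↦ inv_pos.2 (hσpos x hx)) hYX hce hc hceS h0.symm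
  have hkJ := hkmaps hmax'
  have key (t : ℝ) (ht : t ∈ Je) : HasDerivAt (h ∘ k) 1 t := by
    have := (hderiv _ (hkJ ht)).comp t (hkderiv t ht)
    rwa [← hkeq t ht (hkJ ht), mul_inv_cancel₀ (hσpos _ (hceS ht)).ne'] at this
  have hid : EqOn (h ∘ k) id Je :=
    hce.isOpen.eqOn_of_deriv_eq hce.ordConnected.isPreconnected
      (fun t ht ↦ (key t ht).differentiableAt.differentiableWithinAt) differentiableOn_id
      (fun t ht ↦ by rw [(key t ht).deriv, deriv_id]) hce.zero_mem (by simp [hk0, hh0])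
  exact fun t ht ↦ ⟨k t, hkJ ht, hid ht⟩

end Trajectories

/-! ### The dual bundle and its kinetic energy -/

section VectorBundles

variable {B F : Type*} [TopologicalSpace B] [NormedAddCommGroup F] [NormedSpace ℝ F]
  {Z : B → Type*} [TopologicalSpace (TotalSpace F Z)] [∀ b, TopologicalSpace (Z b)]
  [∀ b, AddCommGroup (Z b)] [∀ b, Module ℝ (Z b)] [FiberBundle F Z]

/-- The total space of a fibre bundle over a Hausdorff base with Hausdorff fibre is Hausdorff. -/
lemma t2Space_totalSpace [T2Space B] : T2Space (TotalSpace F Z) := by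
  refine ⟨fun x y hxy ↦ ?_⟩
  by_cases h : x.proj = y.proj
  · let t := trivializationAt F Z x.proj
    have hx : x ∈ t.source := t.mem_source.2 (mem_baseSet_trivializationAt F Z x.proj)
    have hy : y ∈ t.source := t.mem_source.2 (h ▸ mem_baseSet_trivializationAt F Z x.proj)
    obtain ⟨U, U', hU, hU', hxU, hyU, hd⟩ := t2_separation (t.injOn.ne hx hy hxy)
    refine ⟨t.source ∩ t ⁻¹' U, t.source ∩ t ⁻¹' U',
      t.continuousOn.isOpen_inter_preimage t.open_source hU,
      t.continuousOn.isOpen_inter_preimage t.open_source hU', ⟨hx, hxU⟩, ⟨hy, hyU⟩, ?_⟩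
    exact (hd.preimage t).mono inter_subset_right inter_subset_right
  · obtain ⟨U, U', hU, hU', hxU, hyU, hd⟩ := t2_separation h
    exact ⟨_, _, hU.preimage (FiberBundle.continuous_proj F Z),
      hU'.preimage (FiberBundle.continuous_proj F Z), hxU, hyU, hd.preimage _⟩

/-- Fibrewise multiplication by real numbers. -/
def fiberSMul (t : ℝ) (x : TotalSpace F Z) : TotalSpace F Z := ⟨x.1, t • x.2⟩

variable [VectorBundle ℝ F Z]

lemma trivializationAt_fiberSMul {b : B} {x : TotalSpace F Z}
    (hx : x.1 ∈ (trivializationAt F Z b).baseSet) (t : ℝ) :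
    (trivializationAt F Z b (fiberSMul t x)).2 = t • (trivializationAt F Z b x).2 :=
  ((trivializationAt F Z b).linear ℝ hx).map_smul t x.2

variable {E H : Type*} [NormedAddCommGroup E] [NormedSpace ℝ E] [TopologicalSpace H]
  {IB : ModelWithCorners ℝ E H} [ChartedSpace H B] [IsManifold IB ∞ B]

lemma contMDiff_fiberSMul [ContMDiffVectorBundle ∞ F Z IB] :
    ContMDiff (𝓘(ℝ, ℝ).prod (IB.prod 𝓘(ℝ, F))) (IB.prod 𝓘(ℝ, F)) ∞
      (fun p : ℝ × TotalSpace F Z ↦ fiberSMul p.1 p.2) := by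
  intro p
  rw [contMDiffAt_totalSpace]
  have hp : ContMDiff (𝓘(ℝ, ℝ).prod (IB.prod 𝓘(ℝ, F))) IB ∞ (fun p : ℝ × TotalSpace F Z ↦ p.2.1) :=
    (contMDiff_proj Z).comp contMDiff_snd
  refine ⟨hp.contMDiffAt, ?_⟩
  have hmem := (trivializationAt F Z p.2.1).open_baseSet.mem_nhds
    (mem_baseSet_trivializationAt F Z p.2.1)
  have h1 : ContMDiffAt (𝓘(ℝ, ℝ).prod (IB.prod 𝓘(ℝ, F))) 𝓘(ℝ, F) ∞
      (fun p' : ℝ × TotalSpace F Z ↦ p'.1 • (trivializationAt F Z p.2.1 p'.2).2) p :=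
    contMDiffAt_fst.smul ((contMDiffAt_totalSpace (f := fun p' : ℝ × TotalSpace F Z ↦ p'.2)).1
      contMDiffAt_snd).2
  refine h1.congr_of_eventuallyEq ?_
  filter_upwards [hp.continuous.continuousAt hmem] with p' hp'
  exact trivializationAt_fiberSMul hp' p'.1

end VectorBundles

section DualBundle

variable {E : Type*} [NormedAddCommGroup E] [NormedSpace ℝ E]
  {Q : Type*} [TopologicalSpace Q] [ChartedSpace E Q] [IsManifold 𝓘(ℝ, E) ∞ Q]
  {F : Type*} [NormedAddCommGroup F] [NormedSpace ℝ F]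
  {A : Q → Type*} [TopologicalSpace (TotalSpace F A)]
  [∀ q, TopologicalSpace (A q)] [∀ q, AddCommGroup (A q)] [∀ q, Module ℝ (A q)]
  [∀ q, IsTopologicalAddGroup (A q)] [∀ q, ContinuousSMul ℝ (A q)]
  [FiberBundle F A] [VectorBundle ℝ F A]

variable (F A) in
/-- The preferred trivialization of the dual bundle. -/
abbrev dualTrivialization (q₀ : Q) :
    Trivialization (F →L[ℝ] ℝ) (π (F →L[ℝ] ℝ) (fun q : Q ↦ A q →L[ℝ] ℝ)) :=
  trivializationAt (F →L[ℝ] ℝ) (fun q : Q ↦ A q →L[ℝ] ℝ) q₀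

lemma baseSet_dualTrivialization (q₀ : Q) :
    (dualTrivialization F A q₀).baseSet = (trivializationAt F A q₀).baseSet := by
  rw [dualTrivialization, hom_trivializationAt_baseSet]
  exact inter_univ _

lemma mem_baseSet_dualTrivialization (q₀ : Q) : q₀ ∈ (dualTrivialization F A q₀).baseSet :=
  mem_baseSet_trivializationAt _ _ q₀

lemma dualTrivialization_apply {q₀ q : Q} (hq : q ∈ (trivializationAt F A q₀).baseSet)
    (α : A q →L[ℝ] ℝ) (v : F) :
    (dualTrivialization F A q₀ ⟨q, α⟩).2 v
      = α (((trivializationAt F A q₀).continuousLinearEquivAt ℝ q hq).symm v) := by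
  rw [dualTrivialization, hom_trivializationAt_apply,
    ContinuousLinearMap.inCoordinates_eq hq (by trivial)]
  rfl

/-- The isomorphism `b : A_q → A_q*` is an isometry. -/
lemma dualNormSq_apply {q : Q} {b : A q →L[ℝ] A q →L[ℝ] ℝ} (hb : b.IsInvertible) (v : A q) :
    dualNormSq b (b v) = b v v := by
  obtain ⟨e, rfl⟩ := hb
  simp [dualNormSq]

variable [FiniteDimensional ℝ F]

section Metric

variable [ContMDiffVectorBundle ∞ F A 𝓘(ℝ, E)] (g : ContMDiffRiemannianMetric 𝓘(ℝ, E) ∞ F A)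

/-- The scalar product on `F` that represents the metric at `q` in the trivialization at `q₀`; it is
meaningful for `q` in the base set of that trivialization only. -/
def metricInCoordinates (q₀ q : Q) : F →L[ℝ] F →L[ℝ] ℝ :=
  ContinuousLinearMap.inCoordinates F A (F →L[ℝ] ℝ) (fun q ↦ A q →L[ℝ] ℝ) q₀ q q₀ q (g.inner q)

lemma contMDiffAt_metricInCoordinates (q₀ : Q) :
    ContMDiffAt 𝓘(ℝ, E) 𝓘(ℝ, F →L[ℝ] F →L[ℝ] ℝ) ∞ (metricInCoordinates g q₀) q₀ :=
  ((contMDiffAt_hom_bundle _).1 (g.contMDiff q₀)).2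

lemma metricInCoordinates_eq {q₀ q : Q} (hq : q ∈ (trivializationAt F A q₀).baseSet)
    (hq' : q ∈ (dualTrivialization F A q₀).baseSet) :
    metricInCoordinates g q₀ q
      = ((dualTrivialization F A q₀).continuousLinearEquivAt ℝ q hq' : _ →L[ℝ] F →L[ℝ] ℝ) ∘L
        g.inner q ∘L (((trivializationAt F A q₀).continuousLinearEquivAt ℝ q hq).symm :
          F →L[ℝ] A q) :=
  ContinuousLinearMap.inCoordinates_eq hq hq'

lemma metricInCoordinates_apply {q₀ q : Q} (hq : q ∈ (trivializationAt F A q₀).baseSet) (v w : F) :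
    metricInCoordinates g q₀ q v w
      = g.inner q (((trivializationAt F A q₀).continuousLinearEquivAt ℝ q hq).symm v)
        (((trivializationAt F A q₀).continuousLinearEquivAt ℝ q hq).symm w) := by
  have hq' : q ∈ (dualTrivialization F A q₀).baseSet := by rwa [baseSet_dualTrivialization]
  rw [metricInCoordinates_eq g hq hq']
  exact dualTrivialization_apply hq _ w

/-- The metric is nondegenerate, hence invertible in finite dimension; this makes the junk value of
`ContinuousLinearMap.inverse` irrelevant in `dualNormSq`. -/
lemma isInvertible_metricInCoordinates {q₀ q : Q} (hq : q ∈ (trivializationAt F A q₀).baseSet) :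
    (metricInCoordinates g q₀ q).IsInvertible := by
  have hinj : Function.Injective (metricInCoordinates g q₀ q : F →ₗ[ℝ] F →L[ℝ] ℝ) := by
    rw [injective_iff_map_eq_zero]
    intro v hv
    by_contra hne
    have h1 := metricInCoordinates_apply g hq v v
    have h2 := g.pos q (((trivializationAt F A q₀).continuousLinearEquivAt ℝ q hq).symm v)
      fun h ↦ hne (by
        simpa only [ContinuousLinearEquiv.apply_symm_apply, map_zero] using
          congrArg ((trivializationAt F A q₀).continuousLinearEquivAt ℝ q hq) h)
    have h3 : metricInCoordinates g q₀ q v = 0 := hv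
    rw [← h1, h3] at h2
    simp at h2
  have hdim : Module.finrank ℝ F = Module.finrank ℝ (F →L[ℝ] ℝ) := by
    rw [← (LinearMap.toContinuousLinearMap (𝕜 := ℝ) (E := F) (F' := ℝ)).finrank_eq]
    exact Subspace.dual_finrank_eq.symm
  let e := LinearEquiv.ofInjectiveOfFinrankEq _ hinj hdim
  exact ⟨e.toContinuousLinearEquiv, by ext; rfl⟩

lemma isInvertible_inner (q : Q) : (g.inner q).IsInvertible := by
  have hq := mem_baseSet_trivializationAt F A q
  have hq' := mem_baseSet_dualTrivialization (F := F) (A := A) q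
  obtain ⟨e, he⟩ := isInvertible_metricInCoordinates g hq
  have h1 := metricInCoordinates_eq g hq hq'
  rw [← he] at h1
  generalize (trivializationAt F A q).continuousLinearEquivAt ℝ q hq = e₁ at h1
  generalize (dualTrivialization F A q).continuousLinearEquivAt ℝ q hq' = e₂ at h1
  refine ⟨e₁.trans (e.trans e₂.symm), ?_⟩
  ext1 v
  have h2 := congrArg (fun T : F →L[ℝ] F →L[ℝ] ℝ ↦ e₂.symm (T (e₁ v))) h1
  simpa using h2

lemma exists_inner_eq {q : Q} (α : A q →L[ℝ] ℝ) : ∃ v : A q, g.inner q v = α := by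
  obtain ⟨e, he⟩ := isInvertible_inner g q
  exact ⟨e.symm α, by rw [← he]; simp⟩

lemma dualNormSq_pos {q : Q} {α : A q →L[ℝ] ℝ} (hα : α ≠ 0) : 0 < dualNormSq (g.inner q) α := by
  obtain ⟨v, rfl⟩ := exists_inner_eq g α
  rw [dualNormSq_apply (isInvertible_inner g q)]
  exact g.pos q v fun hv ↦ hα (by simp [hv])

lemma dualNormSq_smul_right {q : Q} (b : A q →L[ℝ] A q →L[ℝ] ℝ) (t : ℝ) (α : A q →L[ℝ] ℝ) :
    dualNormSq b (t • α) = t ^ 2 * dualNormSq b α := by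
  simp [dualNormSq]
  ring

lemma dualNormSq_smul_left {q : Q} {b : A q →L[ℝ] A q →L[ℝ] ℝ} (hb : b.IsInvertible) {t : ℝ}
    (ht : t ≠ 0) (α : A q →L[ℝ] ℝ) : dualNormSq (t • b) α = t⁻¹ * dualNormSq b α := by
  obtain ⟨G, rfl⟩ := hb
  have h1 : (t • (G : A q →L[ℝ] A q →L[ℝ] ℝ)).IsInvertible := by
    refine ⟨(ContinuousLinearEquiv.smulLeft (Units.mk0 t ht) : A q ≃L[ℝ] A q).trans G, ?_⟩
    ext v w
    simp
  have h2 : (t • (G : A q →L[ℝ] A q →L[ℝ] ℝ)) (t⁻¹ • G.symm α) = α := by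
    simp [smul_smul, ht]
  have h3 := dualNormSq_apply h1 (t⁻¹ • G.symm α)
  have h4 := dualNormSq_apply (b := (G : A q →L[ℝ] A q →L[ℝ] ℝ)) ⟨G, rfl⟩ (G.symm α)
  rw [h2] at h3
  rw [h3]
  simp only [ContinuousLinearEquiv.coe_coe, ContinuousLinearEquiv.apply_symm_apply] at h4
  rw [h4]
  simp

lemma dualNormSq_eq {q₀ q : Q} (hq : q ∈ (trivializationAt F A q₀).baseSet) (α : A q →L[ℝ] ℝ) :
    dualNormSq (g.inner q) α = (dualTrivialization F A q₀ ⟨q, α⟩).2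
      ((metricInCoordinates g q₀ q).inverse (dualTrivialization F A q₀ ⟨q, α⟩).2) := by
  obtain ⟨v, rfl⟩ := exists_inner_eq g α
  rw [dualNormSq_apply (isInvertible_inner g q)]
  set e := (trivializationAt F A q₀).continuousLinearEquivAt ℝ q hq
  have h : (dualTrivialization F A q₀ ⟨q, g.inner q v⟩).2 = metricInCoordinates g q₀ q (e v) := by
    ext w
    rw [dualTrivialization_apply hq, metricInCoordinates_apply g hq, e.symm_apply_apply]
  obtain ⟨G, hG⟩ := isInvertible_metricInCoordinates g hq
  rw [h, ← hG, ContinuousLinearMap.inverse_equiv, ContinuousLinearEquiv.coe_coe,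
    ContinuousLinearEquiv.coe_coe, G.symm_apply_apply, ← ContinuousLinearEquiv.coe_coe, hG,
    metricInCoordinates_apply g hq, e.symm_apply_apply]

/-- The kinetic energy is smooth: in a trivialization it is `y ↦ ½ ⟨y, G⁻¹ y⟩`, and inversion of
matrices is smooth. -/
lemma contMDiff_kinetic :
    ContMDiff (dualModel E F) 𝓘(ℝ, ℝ) ∞ (kinetic g.inner : DualBundle F A → ℝ) := by
  intro α₀
  have hcoord : ContMDiffAt (dualModel E F) 𝓘(ℝ, F →L[ℝ] ℝ) ∞
      (fun α : DualBundle F A ↦ (dualTrivialization F A α₀.1 α).2) α₀ :=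
    ((contMDiffAt_totalSpace (f := fun α : DualBundle F A ↦ α)).1 contMDiffAt_id).2
  have hproj : ContMDiffAt (dualModel E F) 𝓘(ℝ, E) ∞ (fun α : DualBundle F A ↦ α.1) α₀ :=
    contMDiffAt_proj _
  have hq := mem_baseSet_trivializationAt F A α₀.1
  obtain ⟨G, hG⟩ := isInvertible_metricInCoordinates g hq
  have hinv : ContMDiffAt (dualModel E F) 𝓘(ℝ, (F →L[ℝ] ℝ) →L[ℝ] F) ∞
      (fun α : DualBundle F A ↦ (metricInCoordinates g α₀.1 α.1).inverse) α₀ := by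
    have h1 : ContMDiffAt (dualModel E F) 𝓘(ℝ, F →L[ℝ] F →L[ℝ] ℝ) ∞
        (fun α : DualBundle F A ↦ metricInCoordinates g α₀.1 α.1) α₀ :=
      (contMDiffAt_metricInCoordinates g α₀.1).comp α₀ hproj
    have h2 := contDiffAt_map_inverse (n := ∞) G
    rw [hG] at h2
    exact h2.contMDiffAt.comp α₀ h1
  have h3 : ContMDiffAt (dualModel E F) 𝓘(ℝ, ℝ) ∞ (fun α : DualBundle F A ↦
      (dualTrivialization F A α₀.1 α).2 ((metricInCoordinates g α₀.1 α.1).inverse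
        (dualTrivialization F A α₀.1 α).2) / 2) α₀ :=
    (hcoord.clm_apply (hinv.clm_apply hcoord)).div_const 2
  refine h3.congr_of_eventuallyEq ?_
  filter_upwards [hproj.continuousAt ((trivializationAt F A α₀.1).open_baseSet.mem_nhds hq)]
    with α hα
  rw [kinetic, dualNormSq_eq g hα]

end Metric

end DualBundle

/-! ### Linear Poisson structures are homogeneous -/

section LinearFunctions

lemma smul_apply_map_smul {G : Type*} [TopologicalSpace G] [AddCommGroup G] [Module ℝ G]
    (L : (G →L[ℝ] ℝ) →ₗ[ℝ] G) (t : ℝ) (a b : G →L[ℝ] ℝ) :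
    (t • b) (L (t • a)) = t * (t * b (L a)) := by
  simp

variable {E : Type*} [NormedAddCommGroup E] [NormedSpace ℝ E] [FiniteDimensional ℝ E]
  {Q : Type*} [TopologicalSpace Q] [T2Space Q] [ChartedSpace E Q] [IsManifold 𝓘(ℝ, E) ∞ Q]
  {F : Type*} [NormedAddCommGroup F] [NormedSpace ℝ F] [FiniteDimensional ℝ F]
  {A : Q → Type*} [TopologicalSpace (TotalSpace F A)]
  [∀ q, TopologicalSpace (A q)] [∀ q, AddCommGroup (A q)] [∀ q, Module ℝ (A q)]
  [∀ q, IsTopologicalAddGroup (A q)] [∀ q, ContinuousSMul ℝ (A q)]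
  [FiberBundle F A] [VectorBundle ℝ F A] [ContMDiffVectorBundle ∞ F A 𝓘(ℝ, E)]

/-- Every linear functional on `F*` is the evaluation at a vector. -/
lemma exists_forall_apply_eq (b : (F →L[ℝ] ℝ) →L[ℝ] ℝ) : ∃ v : F, ∀ y : F →L[ℝ] ℝ, b y = y v := by
  let b' : Module.Dual ℝ (Module.Dual ℝ F) :=
    b.toLinearMap ∘ₗ (LinearMap.toContinuousLinearMap (𝕜 := ℝ) (E := F) (F' := ℝ)).toLinearMap
  refine ⟨(Module.evalEquiv ℝ F).symm b', fun y ↦ ?_⟩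
  have h := Module.apply_evalEquiv_symm_apply (R := ℝ) (M := F) y.toLinearMap b'
  have h2 : b' y.toLinearMap = b y := congrArg b (by ext; rfl)
  exact h2.symm.trans h.symm

/-- Off the zero section, the differentials of the fibrewise linear functions exhaust the cotangent
spaces of `A*`. In a trivialization one takes `(x, y) ↦ y (v + β₁ (x - x₀) w)` with `y₀ w = 1`. -/
theorem exists_isFiberwiseLinear_mvfderiv_eq {α₀ : DualBundle F A} (h₀ : α₀.2 ≠ 0)
    (β : TangentSpace (dualModel E F) α₀ →L[ℝ] ℝ) :
    ∃ f : DualBundle F A → ℝ, IsFiberwiseLinear (E := E) f ∧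
      mvfderiv (dualModel E F) f α₀ = β := by
  let β' : E × (F →L[ℝ] ℝ) →L[ℝ] ℝ := β
  let T := dualTrivialization F A α₀.1
  let y₀ : F →L[ℝ] ℝ := (T α₀).2
  have hb : α₀.1 ∈ T.baseSet := mem_baseSet_dualTrivialization α₀.1
  have hy₀ : y₀ ≠ 0 := fun h ↦ h₀ <| by
    have h1 : T.continuousLinearEquivAt ℝ α₀.1 hb α₀.2 = 0 := h
    exact (ContinuousLinearEquiv.map_eq_zero_iff _).1 h1
  obtain ⟨w, hw⟩ : ∃ w, y₀ w = 1 := by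
    obtain ⟨w, hw⟩ : ∃ w, y₀ w ≠ 0 := by
      by_contra! h
      exact hy₀ (ContinuousLinearMap.ext h)
    exact ⟨(y₀ w)⁻¹ • w, by simp [hw]⟩
  -- `v` represents the part of `β` along the fibre, and `w` lifts its part along the base
  obtain ⟨v, hv⟩ := exists_forall_apply_eq (β' ∘L ContinuousLinearMap.inr ℝ E (F →L[ℝ] ℝ))
  let φ := extChartAt 𝓘(ℝ, E) α₀.1
  let s : E → F := fun x ↦ v + β' (x - φ α₀.1, 0) • w
  have hs : ContDiff ℝ ∞ s := by
    refine contDiff_const.add (ContDiff.smul ?_ contDiff_const)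
    exact β'.contDiff.comp ((contDiff_id.sub contDiff_const).prodMk contDiff_const)
  have hN : (chartAt E α₀.1).source ∩ T.baseSet ∈ 𝓝 α₀.1 :=
    Filter.inter_mem (chart_source_mem_nhds E α₀.1) (T.open_baseSet.mem_nhds hb)
  obtain ⟨χ, -, hχ⟩ := (SmoothBumpFunction.nhds_basis_tsupport (I := 𝓘(ℝ, E)) α₀.1).mem_iff.1 hN
  -- `f₀` is linear on the fibres over the trivializing set only; `χ` extends it by zero
  let f₀ : DualBundle F A → ℝ := fun α ↦ (T α).2 (s (φ α.1))
  let f : DualBundle F A → ℝ := fun α ↦ χ α.1 * f₀ α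
  have hpr : ContMDiff (dualModel E F) 𝓘(ℝ, E) ∞ (fun α : DualBundle F A ↦ α.1) :=
    contMDiff_proj _
  have hf₀ : ∀ α : DualBundle F A, α.1 ∈ (chartAt E α₀.1).source ∩ T.baseSet →
      ContMDiffAt (dualModel E F) 𝓘(ℝ, ℝ) ∞ f₀ α := by
    intro α hα
    have h1 : ContMDiffAt (dualModel E F) 𝓘(ℝ, F →L[ℝ] ℝ) ∞
        (fun α : DualBundle F A ↦ (T α).2) α :=
      contMDiffAt_snd.comp α (T.contMDiffOn.contMDiffAt
        (T.open_source.mem_nhds (T.mem_source.2 hα.2)))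
    have h2 : ContMDiffAt (dualModel E F) 𝓘(ℝ, E) ∞ (fun α : DualBundle F A ↦ φ α.1) α :=
      (contMDiffAt_extChartAt' hα.1).comp α hpr.contMDiffAt
    exact h1.clm_apply (hs.contMDiff.contMDiffAt.comp α h2)
  refine ⟨f, ⟨?_, fun q ↦ ?_⟩, ?_⟩
  · refine contMDiff_of_tsupport fun α hα ↦ ?_
    have h1 : α.1 ∈ tsupport χ := by
      have h2 : tsupport f ⊆ (fun α : DualBundle F A ↦ α.1) ⁻¹' tsupport χ := by
        refine closure_minimal (fun α hα ↦ subset_closure ?_)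
          ((isClosed_tsupport _).preimage hpr.continuous)
        exact fun h ↦ hα (by simp [f, h])
      exact h2 hα
    exact (χ.contMDiff.contMDiffAt.comp α hpr.contMDiffAt).mul (hf₀ α (hχ h1))
  · by_cases hq : q ∈ T.baseSet
    · have hl := T.linear ℝ hq
      constructor
      · intro a b
        have := hl.map_add a b
        simp only [f, f₀]
        rw [this]
        simp [mul_add]
      · intro c a
        have := hl.map_smul c a
        simp only [f, f₀]
        rw [this]
        simp [mul_left_comm]
    · have : χ q = 0 := by
        by_contra h
        exact hq (hχ (subset_closure h)).2
      exact ⟨fun a b ↦ by simp [f, this], fun c a ↦ by simp [f, this]⟩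
  · have hev : f =ᶠ[𝓝 α₀] f₀ := by
      filter_upwards [hpr.continuous.continuousAt χ.eventuallyEq_one] with α hα
      have : χ α.1 = 1 := hα
      simp [f, this]
    rw [mvfderiv_congr hev]
    have hd : HasMFDerivAt (dualModel E F) 𝓘(ℝ, ℝ) f₀ α₀ β' := by
      refine ⟨(hf₀ α₀ (mem_of_mem_nhds hN)).continuousAt, ?_⟩
      have hx₀ : extChartAt (dualModel E F) α₀ α₀ = (φ α₀.1, y₀) := by
        rw [FiberBundle.extChartAt]
        rfl
      have hev' : ∀ᶠ p in 𝓝 (φ α₀.1, y₀),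
          writtenInExtChartAt (dualModel E F) 𝓘(ℝ, ℝ) α₀ f₀ p = p.2 (s p.1) := by
        rw [← hx₀]
        filter_upwards [extChartAt_target_mem_nhds (I := dualModel E F) α₀] with p hp
        have h1 := (extChartAt (dualModel E F) α₀).right_inv hp
        have h2 := (extChartAt (dualModel E F) α₀).map_target hp
        rw [writtenInExtChartAt, Function.comp_apply, Function.comp_apply]
        set α := (extChartAt (dualModel E F) α₀).symm p
        have h3 : α ∈ T.source := by
          rw [FiberBundle.extChartAt, PartialEquiv.trans_source] at h2
          exact h2.1
        have h4 : extChartAt (dualModel E F) α₀ α = (φ (T α).1, (T α).2) := by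
          rw [FiberBundle.extChartAt]
          rfl
        rw [← h1, h4, T.coe_fst h3]
        rfl
      rw [hx₀]
      refine HasFDerivAt.hasFDerivWithinAt ?_
      refine HasFDerivAt.congr_of_eventuallyEq ?_ hev'
      have h1 : HasFDerivAt (fun p : E × (F →L[ℝ] ℝ) ↦ s p.1)
          ((β' ∘L ContinuousLinearMap.inl ℝ E (F →L[ℝ] ℝ) ∘L
            ContinuousLinearMap.fst ℝ E (F →L[ℝ] ℝ)).smulRight w) (φ α₀.1, y₀) := by
        have h2 : HasFDerivAt (fun p : E × (F →L[ℝ] ℝ) ↦ p.1 - φ α₀.1)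
            (ContinuousLinearMap.fst ℝ E (F →L[ℝ] ℝ)) (φ α₀.1, y₀) :=
          hasFDerivAt_fst.sub_const _
        have h3 := (β' ∘L ContinuousLinearMap.inl ℝ E (F →L[ℝ] ℝ)).hasFDerivAt.comp
          (φ α₀.1, y₀) h2
        exact (h3.smul_const w).const_add v
      have h2 := (hasFDerivAt_snd (𝕜 := ℝ) (p := (φ α₀.1, y₀))).clm_apply h1
      refine h2.congr_fderiv ?_
      refine ContinuousLinearMap.ext fun p ↦ ?_
      have h3 : β' p = β' (p.1, 0) + p.2 v := by
        rw [← hv]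
        simp [← map_add]
      have h4 : s (φ α₀.1) = v := by
        have : ((φ α₀.1 - φ α₀.1, 0) : E × (F →L[ℝ] ℝ)) = 0 := by rw [sub_self]; rfl
        simp only [s, this, map_zero, zero_smul, add_zero]
      change y₀ (β' (p.1, 0) • w) + p.2 (s (φ α₀.1)) = β' p
      rw [h3, h4, _root_.map_smul, hw, smul_eq_mul, mul_one]
    exact ContinuousLinearMap.ext fun p ↦
      congrArg (fun T : E × (F →L[ℝ] ℝ) →L[ℝ] ℝ ↦ T p) hd.mfderiv

/-- A linear Poisson structure is homogeneous of degree `-1` under dilations of the fibres. -/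
theorem IsLinearPoisson.isHomogeneous
    {P : TwoTensorField (dualModel E F) (DualBundle F A)} (hP : IsLinearPoisson P)
    {O : Set (DualBundle F A)} (hO : ∀ α ∈ O, α.2 ≠ 0) : IsHomogeneous P fiberSMul O := by
  -- Differentials of linear functions span, and for linear `f` one has `f ∘ μ_t = t f`.
  intro t ht α hα β γ
  have h0 : (fiberSMul t α).2 ≠ 0 := smul_ne_zero ht.ne' (hO α hα)
  obtain ⟨f, hf, rfl⟩ := exists_isFiberwiseLinear_mvfderiv_eq h0 β
  obtain ⟨g, hg, rfl⟩ := exists_isFiberwiseLinear_mvfderiv_eq h0 γ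
  have hmt : ContMDiff (dualModel E F) (dualModel E F) ∞
      (fiberSMul t : DualBundle F A → DualBundle F A) :=
    contMDiff_fiberSMul.comp (contMDiff_const.prodMk contMDiff_id)
  have key : ∀ f : DualBundle F A → ℝ, IsFiberwiseLinear (E := E) f →
      mvfderiv (dualModel E F) f (fiberSMul t α) ∘L
        mfderiv (dualModel E F) (dualModel E F) (fiberSMul t) α
        = t • mvfderiv (dualModel E F) f α := by
    intro f hf
    have h1 : mvfderiv (dualModel E F) (f ∘ fiberSMul t) α
        = mvfderiv (dualModel E F) (fun α ↦ t * f α) α :=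
      congrArg (fun f ↦ mvfderiv (dualModel E F) f α)
        (funext fun α ↦ (hf.linear α.1).map_smul t α.2)
    have h2 := mvfderiv_comp (g := f) α (hf.smooth.mdifferentiable (by simp) _)
      (hmt.mdifferentiable (by simp) α)
    rw [← h2, h1, mvfderiv_fun_mul mdifferentiableAt_const
      (hf.smooth.mdifferentiable (by simp) _), mvfderiv_const]
    simp
  have h1 := (hP.pairing_linear f g hf hg).linear α.1 |>.map_smul t α.2
  rw [key f hf, key g hg]
  change t * pairing P f g (fiberSMul t α) = _
  change pairing P f g (fiberSMul t α) = t • pairing P f g α at h1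
  rw [h1]
  exact (smul_apply_map_smul (G := TangentSpace (dualModel E F) α) (P α) t _ _).symm

end LinearFunctions

/-! ### Slice charts of the unit sphere of a cone -/

section ConeCharts

variable {E E' E₁ F₁ : Type*} [NormedAddCommGroup E] [NormedSpace ℝ E]
  [NormedAddCommGroup E'] [NormedSpace ℝ E'] [FiniteDimensional ℝ E']
  [NormedAddCommGroup E₁] [NormedSpace ℝ E₁] [FiniteDimensional ℝ E₁]
  [NormedAddCommGroup F₁] [NormedSpace ℝ F₁] [FiniteDimensional ℝ F₁]
  {H : Type*} [TopologicalSpace H] {I : ModelWithCorners ℝ E H}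
  {M : Type*} [TopologicalSpace M] [ChartedSpace H M]
  {μ : ℝ → M → M} {O : Set M} {ρ : M → ℝ} {S : Set M}

/-- A chart with values in `E₁ × F₁` in which the dilations act on the second factor gives slice
charts of the unit sphere `S` of the cone: a point with coordinates `(x, y)` goes to `x`, to the
intersection of the ray of `y` with an affine hyperplane through `y₀`, and to `ρ - 1`. -/
theorem IsNormedCone.exists_isSliceChart (hμ : IsNormedCone I μ O ρ)
    (hS : ∀ x, x ∈ S ↔ x ∈ O ∧ ρ x = 1) (Ξ : OpenPartialHomeomorph M (E₁ × F₁))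
    (hΞ : ContMDiffOn I 𝓘(ℝ, E₁ × F₁) ∞ Ξ Ξ.source)
    (hΞ' : ContMDiffOn 𝓘(ℝ, E₁ × F₁) I ∞ Ξ.symm Ξ.target)
    (hmem : ∀ t > 0, ∀ x ∈ Ξ.source, μ t x ∈ Ξ.source)
    (heq : ∀ t > 0, ∀ x ∈ Ξ.source, Ξ (μ t x) = ((Ξ x).1, t • (Ξ x).2))
    {x₀ : M} (hx₀ : x₀ ∈ Ξ.source) (hx₀' : x₀ ∈ O) (hy₀ : (Ξ x₀).2 ≠ 0)
    (hdim : Module.finrank ℝ E' + 1 = Module.finrank ℝ E₁ + Module.finrank ℝ F₁) :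
    ∃ Θ : OpenPartialHomeomorph M (E' × ℝ), x₀ ∈ Θ.source ∧ IsSliceChart I S Θ := by
  set y₀ := (Ξ x₀).2 with hy₀_def
  obtain ⟨l, hl⟩ := SeparatingDual.exists_eq_one (R := ℝ) hy₀
  let K : Submodule ℝ F₁ := l.ker
  let p : F₁ →L[ℝ] K := (ContinuousLinearMap.id ℝ F₁ - l.smulRight y₀).codRestrict K fun y ↦ by
    change l (y - l y • y₀) = 0
    simp [hl]
  have hp : ∀ y, (p y : F₁) = y - l y • y₀ := fun y ↦ rfl
  have hK : ∀ u : K, l u = 0 := fun u ↦ u.2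
  have hfin : Module.finrank ℝ (E₁ × K) = Module.finrank ℝ E' := by
    have h1 : Module.finrank ℝ K + 1 = Module.finrank ℝ F₁ := by
      refine Module.Dual.finrank_ker_add_one_of_ne_zero (f := (l : F₁ →ₗ[ℝ] ℝ)) fun h ↦ ?_
      have := congrArg (fun f : F₁ →ₗ[ℝ] ℝ ↦ f y₀) h
      simp [hl] at this
    rw [Module.finrank_prod]
    lia
  let L : (E₁ × K) ≃L[ℝ] E' := ContinuousLinearEquiv.ofFinrankEq hfin
  -- the point of the affine hyperplane `l = 1` with the given coordinates in the slice
  let pt : E' → E₁ × F₁ := fun z ↦ ((L.symm z).1, y₀ + (L.symm z).2)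
  have hpt : ContDiff ℝ ∞ pt :=
    (contDiff_fst.comp L.symm.contDiff).prodMk
      (contDiff_const.add (K.subtypeL.contDiff.comp (contDiff_snd.comp L.symm.contDiff)))
  let σ : E' → M := fun z ↦ Ξ.symm (pt z)
  let src : Set M := (Ξ.source ∩ Ξ ⁻¹' {v | 0 < l v.2}) ∩ O
  let tgt : Set (E' × ℝ) := (fun v ↦ pt v.1) ⁻¹' (Ξ.target ∩ Ξ.symm ⁻¹' O) ∩ {v | -1 < v.2}
  let fwd : M → E' × ℝ := fun x ↦ (L ((Ξ x).1, (l (Ξ x).2)⁻¹ • p (Ξ x).2), ρ x - 1)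
  let bwd : E' × ℝ → M := fun v ↦ μ ((v.2 + 1) * (ρ (σ v.1))⁻¹) (σ v.1)
  have hpt_fwd : ∀ x ∈ src, pt (fwd x).1 = Ξ (μ (l (Ξ x).2)⁻¹ x) := by
    rintro x ⟨⟨hx, hlx⟩, -⟩
    have hlx' : l (Ξ x).2 ≠ 0 := ne_of_gt hlx
    rw [heq _ (inv_pos.2 hlx) x hx]
    simp [pt, fwd, hp, smul_sub, hlx']
  have hσ_fwd : ∀ x ∈ src, σ (fwd x).1 = μ (l (Ξ x).2)⁻¹ x := by
    intro x hx
    simp only [σ]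
    rw [hpt_fwd x hx]
    exact Ξ.left_inv (hmem _ (inv_pos.2 hx.1.2) x hx.1.1)
  have hfac : ∀ v ∈ tgt, 0 < (v.2 + 1) * (ρ (σ v.1))⁻¹ := by
    intro v hv
    have h1 : -1 < v.2 := hv.2
    exact mul_pos (by linarith) (inv_pos.2 (hμ.pos _ hv.1.2))
  have hΞ_bwd : ∀ v ∈ tgt, Ξ (bwd v)
      = ((pt v.1).1, ((v.2 + 1) * (ρ (σ v.1))⁻¹) • (pt v.1).2) := by
    intro v hv
    have h1 : Ξ (σ v.1) = pt v.1 := Ξ.right_inv hv.1.1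
    simp only [bwd]
    rw [heq _ (hfac v hv) _ (Ξ.map_target hv.1.1), h1]
  have hl_bwd : ∀ v ∈ tgt, l (Ξ (bwd v)).2 = (v.2 + 1) * (ρ (σ v.1))⁻¹ := by
    intro v hv
    rw [hΞ_bwd v hv]
    simp [pt, hl, hK]
  have hfwd : ContMDiffOn I 𝓘(ℝ, E' × ℝ) ∞ fwd src := by
    have h1 : ContMDiffOn I 𝓘(ℝ, E₁ × F₁) ∞ Ξ src := hΞ.mono fun x hx ↦ hx.1.1
    have h2 : ContMDiffOn I 𝓘(ℝ, E₁) ∞ (fun x ↦ (Ξ x).1) src :=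
      contDiff_fst.contMDiff.comp_contMDiffOn h1
    have h3 : ContMDiffOn I 𝓘(ℝ, F₁) ∞ (fun x ↦ (Ξ x).2) src :=
      contDiff_snd.contMDiff.comp_contMDiffOn h1
    have h4 : ContMDiffOn I 𝓘(ℝ, ℝ) ∞ (fun x ↦ (l (Ξ x).2)⁻¹) src :=
      (l.contDiff.contMDiff.comp_contMDiffOn h3).inv₀ fun x hx ↦ ne_of_gt hx.1.2
    refine ContMDiffOn.prodMk_space ?_ ((hμ.contMDiffOn.mono fun x hx ↦ hx.2).sub
      contMDiffOn_const)
    exact L.contDiff.contMDiff.comp_contMDiffOn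
      (h2.prodMk_space (h4.smul (p.contDiff.contMDiff.comp_contMDiffOn h3)))
  have hσ : ContMDiffOn 𝓘(ℝ, E' × ℝ) I ∞ (fun v ↦ σ v.1) tgt :=
    hΞ'.comp (hpt.comp contDiff_fst).contMDiff.contMDiffOn fun v hv ↦ hv.1.1
  have hbwd : ContMDiffOn 𝓘(ℝ, E' × ℝ) I ∞ bwd tgt := by
    refine hμ.contMDiff_smul.comp_contMDiffOn (ContMDiffOn.prodMk ?_ hσ)
    refine ContMDiffOn.mul ?_ ((hμ.contMDiffOn.comp hσ fun v hv ↦ hv.1.2).inv₀ fun v hv ↦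
      (hμ.pos _ hv.1.2).ne')
    exact (contDiff_snd.add contDiff_const).contMDiff.contMDiffOn
  let Θ : OpenPartialHomeomorph M (E' × ℝ) :=
    { toFun := fwd
      invFun := bwd
      source := src
      target := tgt
      map_source' := by
        intro x hx
        refine ⟨⟨?_, ?_⟩, ?_⟩
        · change pt (fwd x).1 ∈ Ξ.target
          rw [hpt_fwd x hx]
          exact Ξ.map_source (hmem _ (inv_pos.2 hx.1.2) x hx.1.1)
        · change σ (fwd x).1 ∈ O
          rw [hσ_fwd x hx]
          exact hμ.smul_mem _ (inv_pos.2 hx.1.2) x hx.2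
        · have := hμ.pos x hx.2
          change -1 < ρ x - 1
          linarith
      map_target' := by
        intro v hv
        refine ⟨⟨hmem _ (hfac v hv) _ (Ξ.map_target hv.1.1), ?_⟩,
          hμ.smul_mem _ (hfac v hv) _ hv.1.2⟩
        change 0 < l (Ξ (bwd v)).2
        rw [hl_bwd v hv]
        exact hfac v hv
      left_inv' := by
        intro x hx
        have h1 : l (Ξ x).2 ≠ 0 := ne_of_gt hx.1.2
        have h2 := (hμ.pos x hx.2).ne'
        simp only [bwd]
        rw [hσ_fwd x hx, hμ.map_smul _ (inv_pos.2 hx.1.2) x hx.2, hμ.smul_smul]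
        have h3 : ((fwd x).2 + 1) * ((l (Ξ x).2)⁻¹ * ρ x)⁻¹ * (l (Ξ x).2)⁻¹ = 1 := by
          simp only [fwd]
          field_simp
          ring
        rw [h3, hμ.one_smul]
      right_inv' := by
        intro v hv
        have h1 := (hfac v hv).ne'
        have h2 : ρ (bwd v) = v.2 + 1 := by
          simp only [bwd]
          rw [hμ.map_smul _ (hfac v hv) _ hv.1.2, mul_assoc,
            inv_mul_cancel₀ (hμ.pos _ hv.1.2).ne', mul_one]
        refine Prod.ext ?_ (by simp [fwd, h2])
        change L ((Ξ (bwd v)).1, (l (Ξ (bwd v)).2)⁻¹ • p (Ξ (bwd v)).2) = v.1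
        rw [hl_bwd v hv, hΞ_bwd v hv, _root_.map_smul, _root_.smul_smul, inv_mul_cancel₀ h1,
          _root_.one_smul]
        have h3 : p (pt v.1).2 = (L.symm v.1).2 := by
          ext
          simp [hp, pt, hl, hK]
        rw [h3]
        exact L.apply_symm_apply v.1
      open_source := (Ξ.isOpen_inter_preimage
        (isOpen_lt continuous_const (l.continuous.comp continuous_snd))).inter hμ.isOpen
      open_target := ((Ξ.symm.isOpen_inter_preimage hμ.isOpen).preimage
        (hpt.continuous.comp continuous_fst)).inter (isOpen_lt continuous_const continuous_snd)
      continuousOn_toFun := hfwd.continuousOn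
      continuousOn_invFun := hbwd.continuousOn }
  refine ⟨Θ, ⟨⟨hx₀, ?_⟩, hx₀'⟩, hfwd, hbwd, fun x hx ↦ ?_⟩
  · change 0 < l y₀
    rw [hl]
    exact one_pos
  · change x ∈ S ↔ ρ x - 1 = 0
    rw [hS, sub_eq_zero]
    exact and_iff_right hx.2

end ConeCharts

/-! ### The unit sphere bundle of the Jacobi metric -/

section JacobiMetric

variable {E : Type*} [NormedAddCommGroup E] [NormedSpace ℝ E]
  {Q : Type*} [TopologicalSpace Q] [ChartedSpace E Q] [IsManifold 𝓘(ℝ, E) ∞ Q]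
  {F : Type*} [NormedAddCommGroup F] [NormedSpace ℝ F] [FiniteDimensional ℝ F]
  {A : Q → Type*} [TopologicalSpace (TotalSpace F A)]
  [∀ q, TopologicalSpace (A q)] [∀ q, AddCommGroup (A q)] [∀ q, Module ℝ (A q)]
  [∀ q, IsTopologicalAddGroup (A q)] [∀ q, ContinuousSMul ℝ (A q)]
  [FiberBundle F A] [VectorBundle ℝ F A] [ContMDiffVectorBundle ∞ F A 𝓘(ℝ, E)]
  (g : ContMDiffRiemannianMetric 𝓘(ℝ, E) ∞ F A) (V : Q → ℝ) (e : ℝ)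

lemma kinetic_fiberSMul (t : ℝ) (α : DualBundle F A) :
    kinetic g.inner (fiberSMul t α) = t ^ 2 * kinetic g.inner α := by
  exact (congrArg (· / 2) (dualNormSq_smul_right (g.inner α.1) t α.2)).trans (mul_div_assoc _ _ _)

lemma kinetic_pos_iff (α : DualBundle F A) : 0 < kinetic g.inner α ↔ α.2 ≠ 0 := by
  refine ⟨fun h h0 ↦ ?_, fun h ↦ half_pos (dualNormSq_pos g h)⟩
  rw [kinetic, h0] at h
  simp [dualNormSq] at h

/-- The open cone of the covectors over `{V < e}` that do not vanish, nonvanishing being expressed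
by positivity of the kinetic energy. -/
def jacobiCone : Set (DualBundle F A) := {α | V α.1 < e ∧ 0 < kinetic g.inner α}

/-- The norm `‖α‖ = √(2 κ(α))` defined by the Jacobi metric. As the dual norm of `2 (e - V) g` is
that of `g` divided by `√(2 (e - V))`, it is `√(κ_g / (e - V))`; it is a junk value outside
`{V < e}`. -/
def jacobiNorm (α : DualBundle F A) : ℝ := √(kinetic g.inner α / (e - V α.1))

variable {V}

theorem isNormedCone_jacobiNorm (hV : ContMDiff 𝓘(ℝ, E) 𝓘(ℝ, ℝ) ∞ V) :
    IsNormedCone (dualModel E F) fiberSMul (jacobiCone g V e) (jacobiNorm g V e) where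
  isOpen :=
    (isOpen_lt (hV.continuous.comp (FiberBundle.continuous_proj _ _)) continuous_const).inter
    (isOpen_lt continuous_const (contMDiff_kinetic g).continuous)
  contMDiff_smul := contMDiff_fiberSMul
  one_smul α := congrArg (TotalSpace.mk α.1) (_root_.one_smul ℝ α.2)
  smul_smul s t α := congrArg (TotalSpace.mk α.1) (_root_.smul_smul s t α.2)
  smul_mem t ht α hα := ⟨hα.1, by rw [kinetic_fiberSMul]; exact mul_pos (by positivity) hα.2⟩
  pos α hα := Real.sqrt_pos.2 (div_pos hα.2 (sub_pos.2 hα.1))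
  contMDiffOn := by
    intro α hα
    have h0 : 0 < kinetic g.inner α / (e - V α.1) := div_pos hα.2 (sub_pos.2 hα.1)
    have h1 : ContMDiffAt (dualModel E F) 𝓘(ℝ, ℝ) ∞
        (fun α : DualBundle F A ↦ kinetic g.inner α / (e - V α.1)) α :=
      (contMDiff_kinetic g).contMDiffAt.div₀
        (contMDiffAt_const.sub (hV.contMDiffAt.comp α (contMDiffAt_proj _))) (sub_pos.2 hα.1).ne'
    exact ((Real.contDiffAt_sqrt h0.ne').contMDiffAt.comp α h1).contMDiffWithinAt
  map_smul t ht α hα := by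
    rw [jacobiNorm, kinetic_fiberSMul, mul_div_assoc, Real.sqrt_mul (by positivity),
      Real.sqrt_sq ht.le]
    rfl

variable {e}

lemma kinetic_jacobiMetric {α : DualBundle F A} (hα : V α.1 < e) :
    kinetic (jacobiMetric g.inner V e) α = kinetic g.inner α / (2 * (e - V α.1)) := by
  have h : 2 * (e - V α.1) ≠ 0 := mul_ne_zero two_ne_zero (sub_pos.2 hα).ne'
  rw [kinetic, jacobiMetric, dualNormSq_smul_left (isInvertible_inner g α.1) h, kinetic]
  field_simp

lemma mem_sphereBundle_iff {α : DualBundle F A} :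
    α ∈ sphereBundle F g.inner V e ↔ V α.1 < e ∧ kinetic g.inner α = e - V α.1 := by
  refine and_congr_right fun h ↦ ?_
  have h1 : V α.1 < e := h
  have h2 := (sub_pos.2 h1).ne'
  rw [kinetic_jacobiMetric g h1, div_eq_iff (mul_ne_zero two_ne_zero h2)]
  constructor <;> intro h <;> linarith

lemma mem_sphereBundle_iff_jacobiNorm {α : DualBundle F A} :
    α ∈ sphereBundle F g.inner V e ↔ α ∈ jacobiCone g V e ∧ jacobiNorm g V e α = 1 := by
  rw [mem_sphereBundle_iff]
  constructor
  · rintro ⟨h1, h2⟩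
    have h3 := sub_pos.2 h1
    exact ⟨⟨h1, h2 ▸ h3⟩, by rw [jacobiNorm, h2, div_self h3.ne', Real.sqrt_one]⟩
  · rintro ⟨⟨h1, -⟩, h2⟩
    rw [jacobiNorm, Real.sqrt_eq_one, div_eq_one_iff_eq (sub_pos.2 h1).ne'] at h2
    exact ⟨h1, h2⟩

lemma mem_sphereBundle_iff_mechanical {α : DualBundle F A} :
    α ∈ sphereBundle F g.inner V e ↔ α ∈ dualOver F A V e ∧ mechanical g.inner V α = e := by
  rw [mem_sphereBundle_iff]
  refine and_congr_right fun _ ↦ ?_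
  rw [mechanical]
  constructor <;> intro h <;> linarith

lemma mem_sphereBundle_iff_sqrt {q : Q} (hq : V q < e) (α : A q →L[ℝ] ℝ) :
    (⟨q, α⟩ : DualBundle F A) ∈ sphereBundle F g.inner V e ↔
      √(dualNormSq (g.inner q) α) = √(2 * (e - V q)) := by
  have h1 := sub_pos.2 hq
  have h0 : 0 ≤ dualNormSq (g.inner q) α := by
    by_cases h : α = 0
    · simp [h, dualNormSq]
    · exact (dualNormSq_pos g h).le
  rw [mem_sphereBundle_iff, Real.sqrt_inj h0 (by linarith), and_iff_right hq, kinetic,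
    div_eq_iff two_ne_zero, mul_comm]

lemma contMDiff_mechanical (hV : ContMDiff 𝓘(ℝ, E) 𝓘(ℝ, ℝ) ∞ V) :
    ContMDiff (dualModel E F) 𝓘(ℝ, ℝ) ∞ (mechanical g.inner V : DualBundle F A → ℝ) :=
  (contMDiff_kinetic g).add (hV.comp (contMDiff_proj _))

lemma contMDiffOn_kinetic_jacobiMetric (hV : ContMDiff 𝓘(ℝ, E) 𝓘(ℝ, ℝ) ∞ V) :
    ContMDiffOn (dualModel E F) 𝓘(ℝ, ℝ) ∞ (kinetic (jacobiMetric g.inner V e) : DualBundle F A → ℝ)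
      (dualOver F A V e) := by
  have h : ContMDiffOn (dualModel E F) 𝓘(ℝ, ℝ) ∞
      (fun α : DualBundle F A ↦ kinetic g.inner α / (2 * (e - V α.1))) (dualOver F A V e) :=
    (contMDiff_kinetic g).contMDiffOn.div₀
      (contMDiffOn_const.mul (contMDiffOn_const.sub (hV.comp (contMDiff_proj _)).contMDiffOn))
      fun α hα ↦ mul_ne_zero two_ne_zero (sub_pos.2 hα).ne'
  exact h.congr fun α hα ↦ kinetic_jacobiMetric g hα

lemma isOpen_dualOver (hV : Continuous V) : IsOpen (dualOver F A V e) :=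
  isOpen_lt (hV.comp (FiberBundle.continuous_proj _ _)) continuous_const

/-- Along the sphere bundle `dκ = d(ρ²/2) = dρ`. -/
lemma mvfderiv_kinetic_jacobiMetric (hV : ContMDiff 𝓘(ℝ, E) 𝓘(ℝ, ℝ) ∞ V) {α : DualBundle F A}
    (hα : α ∈ sphereBundle F g.inner V e) :
    mvfderiv (dualModel E F) (kinetic (jacobiMetric g.inner V e)) α
      = mvfderiv (dualModel E F) (jacobiNorm g V e) α := by
  have hα' := (mem_sphereBundle_iff_jacobiNorm g).1 hα
  have hc := isNormedCone_jacobiNorm g e hV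
  have hρ : MDifferentiableAt (dualModel E F) 𝓘(ℝ, ℝ) (jacobiNorm g V e) α :=
    (hc.contMDiffOn.contMDiffAt (hc.isOpen.mem_nhds hα'.1)).mdifferentiableAt (by simp)
  have hev : kinetic (jacobiMetric g.inner V e)
      =ᶠ[𝓝 α] fun α ↦ 1 / 2 * (jacobiNorm g V e α * jacobiNorm g V e α) := by
    filter_upwards [hc.isOpen.mem_nhds hα'.1] with α' h
    rw [kinetic_jacobiMetric g h.1, jacobiNorm,
      Real.mul_self_sqrt (div_pos h.2 (sub_pos.2 h.1)).le, ← div_div]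
    ring
  have hρ2 : MDifferentiableAt (dualModel E F) 𝓘(ℝ, ℝ)
      (fun α ↦ jacobiNorm g V e α * jacobiNorm g V e α) α := hρ.mul hρ
  rw [mvfderiv_congr hev, mvfderiv_fun_mul mdifferentiableAt_const hρ2,
    mvfderiv_fun_mul hρ hρ, mvfderiv_const, hα'.2]
  ext v
  simp
  ring

/-- As `H - e = 2 (e - V) (κ - 1/2)`, one has `dH = 2 (e - V) dκ` along the sphere bundle. -/
lemma mvfderiv_mechanical (hV : ContMDiff 𝓘(ℝ, E) 𝓘(ℝ, ℝ) ∞ V) {α : DualBundle F A}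
    (hα : α ∈ sphereBundle F g.inner V e) :
    mvfderiv (dualModel E F) (mechanical g.inner V) α
      = (2 * (e - V α.1)) • mvfderiv (dualModel E F) (kinetic (jacobiMetric g.inner V e)) α := by
  have hW := (isOpen_dualOver (F := F) (A := A) (e := e) hV.continuous).mem_nhds hα.1
  have hκ : MDifferentiableAt (dualModel E F) 𝓘(ℝ, ℝ) (kinetic (jacobiMetric g.inner V e)) α :=
    ((contMDiffOn_kinetic_jacobiMetric g hV).contMDiffAt hW).mdifferentiableAt (by simp)
  have hVα : MDifferentiableAt (dualModel E F) 𝓘(ℝ, ℝ)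
      (fun α : DualBundle F A ↦ 2 * (e - V α.1)) α :=
    (contMDiffAt_const.mul (contMDiffAt_const.sub (hV.contMDiffAt.comp α
      (contMDiffAt_proj _)))).mdifferentiableAt (by simp : (∞ : WithTop ℕ∞) ≠ 0)
  have hev : mechanical g.inner V =ᶠ[𝓝 α]
      fun α ↦ 2 * (e - V α.1) * (kinetic (jacobiMetric g.inner V e) α - 1 / 2) + e := by
    filter_upwards [hW] with α' h
    have h1 : V α'.1 < e := h
    have h2 := (sub_pos.2 h1).ne'
    rw [kinetic_jacobiMetric g h1, mechanical]
    field_simp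
    ring
  have hκ1 : MDifferentiableAt (dualModel E F) 𝓘(ℝ, ℝ)
      (fun α ↦ kinetic (jacobiMetric g.inner V e) α - 1 / 2) α := hκ.sub mdifferentiableAt_const
  have hκ2 : MDifferentiableAt (dualModel E F) 𝓘(ℝ, ℝ)
      (fun α ↦ 2 * (e - V α.1) * (kinetic (jacobiMetric g.inner V e) α - 1 / 2)) α := hVα.mul hκ1
  rw [mvfderiv_congr hev, mvfderiv_fun_add hκ2 mdifferentiableAt_const, mvfderiv_fun_mul hVα hκ1,
    mvfderiv_fun_sub hκ mdifferentiableAt_const, mvfderiv_const, mvfderiv_const, hα.2]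
  ext v
  simp

/-- The sphere bundle is an embedded submanifold of codimension one. The truncated subtraction is
harmless: if `F` is trivial, then the sphere bundle is empty. -/
theorem exists_isSmoothEmbedding_sphereBundle [FiniteDimensional ℝ E]
    (hV : ContMDiff 𝓘(ℝ, E) 𝓘(ℝ, ℝ) ∞ V) :
    ∃ (_ : ChartedSpace (EuclideanSpace ℝ (Fin (Module.finrank ℝ E + Module.finrank ℝ F - 1)))
        (sphereBundle F g.inner V e))
      (_ : IsManifold (𝓡 (Module.finrank ℝ E + Module.finrank ℝ F - 1)) ∞
        (sphereBundle F g.inner V e)),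
      Manifold.IsSmoothEmbedding (𝓡 (Module.finrank ℝ E + Module.finrank ℝ F - 1)) (dualModel E F) ∞
        (Subtype.val : sphereBundle F g.inner V e → DualBundle F A) := by
  have hpos : ∀ α ∈ sphereBundle F g.inner V e, 0 < Module.finrank ℝ F := by
    intro α hα
    by_contra h
    have h1 : Subsingleton F := (Module.finrank_zero_iff (R := ℝ)).1 (by lia)
    have h2 : α.2 ≠ 0 :=
      (kinetic_pos_iff g α).1 ((mem_sphereBundle_iff_jacobiNorm g).1 hα).1.2
    refine h2 (ContinuousLinearMap.ext fun v ↦ ?_)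
    let L := (trivializationAt F A α.1).continuousLinearEquivAt ℝ α.1
      (mem_baseSet_trivializationAt F A α.1)
    have h3 : v = 0 := L.injective (Subsingleton.elim _ _)
    rw [h3, map_zero, map_zero]
  have hdual : Module.finrank ℝ (F →L[ℝ] ℝ) = Module.finrank ℝ F := by
    rw [← (LinearMap.toContinuousLinearMap (𝕜 := ℝ) (E := F) (F' := ℝ)).finrank_eq]
    exact Subspace.dual_finrank_eq
  refine exists_isSmoothEmbedding_of_isSliceChart (G := ℝ) (fun α hα ↦ ?_) fun ⟨α, hα⟩ ↦ ?_
  · have hα' := (mem_sphereBundle_iff_jacobiNorm g).1 hα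
    have hb : α.1 ∈ (dualTrivialization F A α.1).baseSet := mem_baseSet_dualTrivialization α.1
    let T := dualTrivialization F A α.1
    let Ξ : OpenPartialHomeomorph (DualBundle F A) (E × (F →L[ℝ] ℝ)) :=
      T.toOpenPartialHomeomorph ≫ₕ
        (chartAt E α.1).prod (OpenPartialHomeomorph.refl (F →L[ℝ] ℝ))
    have hΞ : chartAt (ModelProd E (F →L[ℝ] ℝ)) α = Ξ := FiberBundle.chartedSpace_chartAt α
    have hsrc : ∀ x : DualBundle F A, x ∈ Ξ.source ↔
        x.1 ∈ T.baseSet ∧ x.1 ∈ (chartAt E α.1).source := by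
      intro x
      have h1 : x ∈ Ξ.source ↔ x ∈ T.source ∧ (T x).1 ∈ (chartAt E α.1).source ∧ True := Iff.rfl
      rw [h1, T.mem_source, and_true]
      exact and_congr_right fun h ↦ by rw [T.coe_fst (T.mem_source.2 h)]
    have hΞ_apply : ∀ x ∈ Ξ.source, Ξ x = (chartAt E α.1 x.1, (T x).2) := by
      intro x hx
      change (chartAt E α.1 (T x).1, (T x).2) = _
      rw [T.coe_fst (T.mem_source.2 ((hsrc x).1 hx).1)]
    have hsmooth := contMDiffOn_extChartAt (I := dualModel E F) (x := α) (n := ∞)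
    have hsmooth' := contMDiffOn_extChartAt_symm (I := dualModel E F) (n := ∞) α
    rw [extChartAt_target] at hsmooth'
    simp only [extChartAt, hΞ] at hsmooth hsmooth'
    refine (isNormedCone_jacobiNorm g e hV).exists_isSliceChart
      (fun x ↦ mem_sphereBundle_iff_jacobiNorm g) Ξ hsmooth (hsmooth'.mono fun x hx ↦ ?_)
      (fun t ht x hx ↦ (hsrc _).2 ((hsrc x).1 hx)) ?_
      ((hsrc α).2 ⟨hb, mem_chart_source E α.1⟩) hα'.1
      ?_ ?_
    · simpa using hx
    · intro t ht x hx
      rw [hΞ_apply x hx]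
      refine (hΞ_apply (fiberSMul t x) ((hsrc _).2 ((hsrc x).1 hx))).trans ?_
      exact Prod.ext rfl (trivializationAt_fiberSMul ((hsrc x).1 hx).1 t)
    · intro h
      have h1 : T.continuousLinearEquivAt ℝ α.1 hb α.2 = 0 := h
      exact (kinetic_pos_iff g α).1 hα'.1.2 ((ContinuousLinearEquiv.map_eq_zero_iff _).1 h1)
    · have := hpos α hα
      rw [finrank_euclideanSpace, Fintype.card_fin, hdual]
      lia
  · have := hpos α hα
    refine ⟨ContinuousLinearEquiv.ofFinrankEq ?_⟩
    rw [Module.finrank_prod, Module.finrank_prod, hdual, finrank_euclideanSpace, Fintype.card_fin,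
      Module.finrank_self]
    lia

end JacobiMetric

/-! ### Local triviality of the sphere bundle -/

section UnitSphere

variable {E : Type*} [NormedAddCommGroup E] [NormedSpace ℝ E]
  {H : Type*} [TopologicalSpace H] {I : ModelWithCorners ℝ E H}
  {M : Type*} [TopologicalSpace M] [ChartedSpace H M]
  {E₁ : Type*} [NormedAddCommGroup E₁] [InnerProductSpace ℝ E₁] {k : ℕ}
  [Fact (Module.finrank ℝ E₁ = k + 1)] [IsManifold I ∞ M]

/-- A map from an open set into the unit sphere is smooth if it is smooth as a map into the ambient
Euclidean space. -/
lemma contMDiffOn_of_coe_sphere {f : M → Metric.sphere (0 : E₁) 1} {U : Set M} (hU : IsOpen U)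
    (hf : ContMDiffOn I 𝓘(ℝ, E₁) ∞ (fun x ↦ (f x : E₁)) U) : ContMDiffOn I (𝓡 k) ∞ f U := by
  intro x hx
  let U' : TopologicalSpace.Opens M := ⟨U, hU⟩
  have h1 : ContMDiff I 𝓘(ℝ, E₁) ∞ (fun y : U' ↦ (f y : E₁)) := fun y ↦
    (contMDiffAt_subtype_iff (U := U') (f := fun x ↦ (f x : E₁)) (x := y)).2
      (hf.contMDiffAt (hU.mem_nhds y.2))
  have h2 : ContMDiff I (𝓡 k) ∞ (fun y : U' ↦ f y) :=
    h1.codRestrict_sphere fun y ↦ (f y).2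
  exact ((contMDiffAt_subtype_iff (U := U') (f := f) (x := ⟨x, hx⟩)).1 (h2 _)).contMDiffWithinAt

open Classical in
/-- The direction `y / ‖y‖` of a nonzero vector; `u₀` is a default value for `y = 0`. -/
def direction (u₀ : Metric.sphere (0 : E₁) 1) (y : E₁) : Metric.sphere (0 : E₁) 1 :=
  if h : y = 0 then u₀ else ⟨‖y‖⁻¹ • y, by
    rw [mem_sphere_zero_iff_norm, norm_smul, norm_inv, norm_norm,
      inv_mul_cancel₀ (norm_ne_zero_iff.2 h)]⟩

lemma coe_direction (u₀ : Metric.sphere (0 : E₁) 1) {y : E₁} (h : y ≠ 0) :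
    (direction u₀ y : E₁) = ‖y‖⁻¹ • y := by
  rw [direction, dif_neg h]

lemma direction_smul (u₀ u : Metric.sphere (0 : E₁) 1) {t : ℝ} (ht : 0 < t) :
    direction u₀ (t • (u : E₁)) = u := by
  have hu : ‖(u : E₁)‖ = 1 := norm_eq_of_mem_sphere u
  ext
  rw [coe_direction _ (smul_ne_zero ht.ne' (ne_zero_of_mem_unit_sphere u)), norm_smul, hu,
    Real.norm_of_nonneg ht.le, mul_one, smul_smul, inv_mul_cancel₀ ht.ne', one_smul]

lemma contMDiffOn_direction (u₀ : Metric.sphere (0 : E₁) 1) :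
    ContMDiffOn 𝓘(ℝ, E₁) (𝓡 k) ∞ (direction u₀) {0}ᶜ := by
  refine contMDiffOn_of_coe_sphere isOpen_compl_singleton (ContDiffOn.contMDiffOn ?_)
  have h : ContDiffOn ℝ ∞ (fun y : E₁ ↦ ‖y‖⁻¹ • y) {0}ᶜ := fun y hy ↦
    (((contDiffAt_norm ℝ hy).inv (norm_ne_zero_iff.2 hy)).smul contDiffAt_id).contDiffWithinAt
  exact h.congr fun y hy ↦ coe_direction u₀ hy

end UnitSphere

section LocalTriviality

variable {E : Type*} [NormedAddCommGroup E] [NormedSpace ℝ E]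
  {Q : Type*} [TopologicalSpace Q] [ChartedSpace E Q] [IsManifold 𝓘(ℝ, E) ∞ Q]
  {F : Type*} [NormedAddCommGroup F] [NormedSpace ℝ F] [FiniteDimensional ℝ F]
  {A : Q → Type*} [TopologicalSpace (TotalSpace F A)]
  [∀ q, TopologicalSpace (A q)] [∀ q, AddCommGroup (A q)] [∀ q, Module ℝ (A q)]
  [∀ q, IsTopologicalAddGroup (A q)] [∀ q, ContinuousSMul ℝ (A q)]
  [FiberBundle F A] [VectorBundle ℝ F A] [ContMDiffVectorBundle ∞ F A 𝓘(ℝ, E)]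
  (g : ContMDiffRiemannianMetric 𝓘(ℝ, E) ∞ F A) {V : Q → ℝ} {e : ℝ}
  {E' H' : Type*} [NormedAddCommGroup E'] [NormedSpace ℝ E'] [TopologicalSpace H']
  {J : ModelWithCorners ℝ E' H'}

/-- Local triviality of the sphere bundle. In a trivialization of `A*` a point `(q, y)` goes to
`(q, y / ‖y‖)` for an auxiliary Euclidean norm; the inverse rescales `(q, u)` to the unit sphere of
the Jacobi metric. -/
theorem exists_trivialization_sphereBundle {S : Set (DualBundle F A)}
    (hS : S = sphereBundle F g.inner V e) [ChartedSpace H' S] [IsManifold J ∞ S]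
    (hι : Manifold.IsSmoothEmbedding J (dualModel E F) ∞ (Subtype.val : S → DualBundle F A))
    (hV : ContMDiff 𝓘(ℝ, E) 𝓘(ℝ, ℝ) ∞ V) {k : ℕ} (hk : Module.finrank ℝ F = k + 1) {q : Q}
    (hq : V q < e) :
    ∃ t : Trivialization (Metric.sphere (0 : EuclideanSpace ℝ (Fin (k + 1))) 1)
        (fun α : S ↦ α.1.1),
      q ∈ t.baseSet ∧
      ContMDiffOn J (𝓘(ℝ, E).prod (𝓡 k)) ∞ t t.source ∧
      ContMDiffOn (𝓘(ℝ, E).prod (𝓡 k)) J ∞ t.toOpenPartialHomeomorph.symm t.target := by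
  have hμ := isNormedCone_jacobiNorm g e hV
  have hS' : ∀ α, α ∈ S ↔ α ∈ jacobiCone g V e ∧ jacobiNorm g V e α = 1 := fun α ↦ by
    rw [hS, mem_sphereBundle_iff_jacobiNorm]
  have hdual : Module.finrank ℝ (F →L[ℝ] ℝ)
      = Module.finrank ℝ (EuclideanSpace ℝ (Fin (k + 1))) := by
    rw [finrank_euclideanSpace, Fintype.card_fin, ← hk,
      ← (LinearMap.toContinuousLinearMap (𝕜 := ℝ) (E := F) (F' := ℝ)).finrank_eq]
    exact Subspace.dual_finrank_eq
  let N : (F →L[ℝ] ℝ) ≃L[ℝ] EuclideanSpace ℝ (Fin (k + 1)) :=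
    ContinuousLinearEquiv.ofFinrankEq hdual
  obtain ⟨u₀⟩ : Nonempty (Metric.sphere (0 : EuclideanSpace ℝ (Fin (k + 1))) 1) :=
    (NormedSpace.sphere_nonempty.2 zero_le_one).to_subtype
  let T := dualTrivialization F A q
  have hTq : q ∈ T.baseSet := mem_baseSet_dualTrivialization q
  let U : Set Q := T.baseSet ∩ {q | V q < e}
  have hU : IsOpen U := T.open_baseSet.inter (isOpen_lt hV.continuous continuous_const)
  let lift : Q × Metric.sphere (0 : EuclideanSpace ℝ (Fin (k + 1))) 1 → DualBundle F A :=
    fun p ↦ T.toOpenPartialHomeomorph.symm (p.1, N.symm p.2)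
  have hlift_mem : ∀ p, p.1 ∈ U → lift p ∈ T.source := fun p hp ↦
    T.map_target (T.mem_target.2 hp.1)
  have hT_lift : ∀ p, p.1 ∈ U → T (lift p) = (p.1, N.symm p.2) := fun p hp ↦
    T.right_inv (T.mem_target.2 hp.1)
  have hlift_fst : ∀ p, p.1 ∈ U → (lift p).1 = p.1 := fun p hp ↦ by
    rw [← T.coe_fst (hlift_mem p hp), hT_lift p hp]
  have hT_zero : ∀ α : DualBundle F A, α.1 ∈ T.baseSet → ((T α).2 = 0 ↔ α.2 = 0) := by
    intro α hα
    have h : (T α).2 = T.continuousLinearEquivAt ℝ α.1 hα α.2 := rfl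
    rw [h, ContinuousLinearEquiv.map_eq_zero_iff]
  have hlift_cone : ∀ p, p.1 ∈ U → lift p ∈ jacobiCone g V e := by
    intro p hp
    have h1 : V (lift p).1 < e := by rw [hlift_fst p hp]; exact hp.2
    refine ⟨h1, (kinetic_pos_iff g _).2 fun h ↦ ?_⟩
    have h2 := (hT_zero _ (by rw [hlift_fst p hp]; exact hp.1)).2 h
    rw [hT_lift p hp] at h2
    exact ne_zero_of_mem_unit_sphere p.2 ((ContinuousLinearEquiv.map_eq_zero_iff N.symm).1 h2)
  have hy₀ := hlift_cone (q, u₀) ⟨hTq, hq⟩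
  -- `S` is nonempty; the point only serves as a default value of the radial retraction
  obtain ⟨y₀⟩ : Nonempty S := ⟨⟨_, (hS' _).2 ⟨hμ.smul_mem _ (inv_pos.2 (hμ.pos _ hy₀)) _ hy₀, by
    rw [hμ.map_smul _ (inv_pos.2 (hμ.pos _ hy₀)) _ hy₀, inv_mul_cancel₀ (hμ.pos _ hy₀).ne']⟩⟩⟩
  let r := hμ.retraction hS' y₀
  let fwd : S → Q × Metric.sphere (0 : EuclideanSpace ℝ (Fin (k + 1))) 1 :=
    fun α ↦ (α.1.1, direction u₀ (N (T α.1).2))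
  have hNT : ∀ α : S, α.1.1 ∈ U → N (T α.1).2 ≠ 0 := fun α hα h ↦
    (kinetic_pos_iff g _).1 ((hS' _).1 α.2).1.2
      ((hT_zero _ hα.1).1 ((ContinuousLinearEquiv.map_eq_zero_iff N).1 h))
  have hval : ContMDiff J (dualModel E F) ∞ (Subtype.val : S → DualBundle F A) := hι.contMDiff
  have hproj : ContMDiff J 𝓘(ℝ, E) ∞ (fun α : S ↦ α.1.1) := (contMDiff_proj _).comp hval
  have hsrc : IsOpen ((fun α : S ↦ α.1.1) ⁻¹' U) := hU.preimage hproj.continuous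
  have hfwd : ContMDiffOn J (𝓘(ℝ, E).prod (𝓡 k)) ∞ fwd ((fun α : S ↦ α.1.1) ⁻¹' U) := by
    refine hproj.contMDiffOn.prodMk ?_
    have h1 : ContMDiffOn J (dualModel E F) ∞ (fun α : S ↦ T α.1) ((fun α : S ↦ α.1.1) ⁻¹' U) :=
      T.contMDiffOn.comp hval.contMDiffOn fun α hα ↦ T.mem_source.2 hα.1
    have h2 : ContMDiffOn J 𝓘(ℝ, EuclideanSpace ℝ (Fin (k + 1))) ∞ (fun α : S ↦ N (T α.1).2)
        ((fun α : S ↦ α.1.1) ⁻¹' U) :=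
      N.contDiff.contMDiff.comp_contMDiffOn (contMDiff_snd.comp_contMDiffOn h1)
    exact (contMDiffOn_direction u₀).comp h2 hNT
  have hbwd : ContMDiffOn (𝓘(ℝ, E).prod (𝓡 k)) J ∞ (fun p ↦ r (lift p)) (U ×ˢ univ) := by
    have h1 : ContMDiff (𝓘(ℝ, E).prod (𝓡 k)) (dualModel E F) ∞
        (fun p : Q × Metric.sphere (0 : EuclideanSpace ℝ (Fin (k + 1))) 1 ↦
          (p.1, N.symm (p.2 : EuclideanSpace ℝ (Fin (k + 1))))) :=
      contMDiff_fst.prodMk (N.symm.contDiff.contMDiff.comp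
        (contMDiff_coe_sphere.comp contMDiff_snd))
    have h2 : ContMDiffOn (𝓘(ℝ, E).prod (𝓡 k)) (dualModel E F) ∞ lift (U ×ˢ univ) :=
      T.contMDiffOn_symm.comp h1.contMDiffOn fun p hp ↦ T.mem_target.2 hp.1.1
    exact (hμ.contMDiffOn_retraction hS' y₀ hι).comp h2 fun p hp ↦ hlift_cone p hp.1
  have hr_lift : ∀ p, p.1 ∈ U → (r (lift p) : DualBundle F A)
      = fiberSMul (jacobiNorm g V e (lift p))⁻¹ (lift p) := fun p hp ↦
    hμ.coe_retraction hS' y₀ (hlift_cone p hp)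
  let t : Trivialization (Metric.sphere (0 : EuclideanSpace ℝ (Fin (k + 1))) 1)
      (fun α : S ↦ α.1.1) :=
    { toFun := fwd
      invFun := fun p ↦ r (lift p)
      source := (fun α : S ↦ α.1.1) ⁻¹' U
      target := U ×ˢ univ
      map_source' := fun α hα ↦ ⟨hα, mem_univ _⟩
      map_target' := fun p hp ↦ by
        change (r (lift p) : DualBundle F A).1 ∈ U
        rw [hr_lift p hp.1]
        exact (hlift_fst p hp.1).symm ▸ hp.1
      left_inv' := fun α hα ↦ by
        have h1 : α.1.1 ∈ U := hα
        have hc : 0 < ‖N (T α.1).2‖⁻¹ := inv_pos.2 (norm_pos_iff.2 (hNT α h1))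
        have h2 : T (fiberSMul ‖N (T α.1).2‖⁻¹ α.1)
            = (α.1.1, N.symm (direction u₀ (N (T α.1).2) : EuclideanSpace ℝ (Fin (k + 1)))) := by
          refine Prod.ext (T.coe_fst (T.mem_source.2 h1.1)) ?_
          refine (trivializationAt_fiberSMul h1.1 _).trans ?_
          rw [coe_direction u₀ (hNT α h1), map_smul, N.symm_apply_apply]
        have h3 : lift (fwd α) = fiberSMul ‖N (T α.1).2‖⁻¹ α.1 := by
          have h4 : (fiberSMul ‖N (T α.1).2‖⁻¹ α.1 : DualBundle F A) ∈ T.source :=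
            T.mem_source.2 h1.1
          have h5 := T.left_inv h4
          change T.toOpenPartialHomeomorph.symm (T _) = _ at h5
          rw [h2] at h5
          exact h5
        change hμ.retraction hS' y₀ (lift (fwd α)) = α
        rw [h3, hμ.retraction_smul hS' y₀ ((hS' _).1 α.2).1 hc, hμ.retraction_coe hS' y₀]
      right_inv' := fun p hp ↦ by
        have hc := inv_pos.2 (hμ.pos _ (hlift_cone p hp.1))
        refine Prod.ext ?_ ?_
        · change (r (lift p) : DualBundle F A).1 = p.1
          rw [hr_lift p hp.1]
          exact hlift_fst p hp.1
        · change direction u₀ (N (T (r (lift p) : DualBundle F A)).2) = p.2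
          have h1 : (T (fiberSMul (jacobiNorm g V e (lift p))⁻¹ (lift p))).2
              = (jacobiNorm g V e (lift p))⁻¹ • N.symm p.2 := by
            refine (trivializationAt_fiberSMul (T.mem_source.1 (hlift_mem p hp.1)) _).trans ?_
            exact congrArg (fun v : Q × (F →L[ℝ] ℝ) ↦ (jacobiNorm g V e (lift p))⁻¹ • v.2)
              (hT_lift p hp.1)
          rw [hr_lift p hp.1, h1, map_smul, N.apply_symm_apply, direction_smul u₀ p.2 hc]
      open_source := hsrc
      open_target := hU.prod isOpen_univ
      continuousOn_toFun := hfwd.continuousOn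
      continuousOn_invFun := hbwd.continuousOn
      baseSet := U
      open_baseSet := hU
      source_eq := rfl
      target_eq := rfl
      proj_toFun := fun _ _ ↦ rfl }
  exact ⟨t, ⟨hTq, hq⟩, hfwd, hbwd⟩

end LocalTriviality

/-! ### Hamiltonian vector fields along the sphere bundle -/

section HamiltonianFields

variable {E : Type*} [NormedAddCommGroup E] [NormedSpace ℝ E]
  {H : Type*} [TopologicalSpace H] {I : ModelWithCorners ℝ E H}
  {M : Type*} [TopologicalSpace M] [ChartedSpace H M] {P : TwoTensorField I M} {f : M → ℝ} {x : M}

lemma IsTwoVector.mvfderiv_hamiltonianField_self (hP : IsTwoVector P) (f : M → ℝ) (x : M) :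
    mvfderiv I f x (hamiltonianField P f x) = 0 := by
  rw [hamiltonianField, map_neg, hP.skew, neg_zero]

lemma hamiltonianField_eq_smul {f' : M → ℝ} {r : ℝ} (h : mvfderiv I f x = r • mvfderiv I f' x) :
    hamiltonianField P f x = r • hamiltonianField P f' x := by
  rw [hamiltonianField, h, map_smul, ← smul_neg, hamiltonianField]

lemma wedge_smul_right (u v : TangentSpace I x) (r : ℝ) : wedge u (r • v) = r • wedge u v := by
  ext α
  have h : α (r • v) = r * α v := by rw [map_smul, smul_eq_mul]
  simp only [wedge, LinearMap.coe_mk, AddHom.coe_mk, LinearMap.smul_apply, smul_sub, smul_smul,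
    h, mul_comm]

lemma IsTwoVector.contMDiffAt_hamiltonianField [FiniteDimensional ℝ E] [T2Space M]
    [IsManifold I ∞ M] (hP : IsTwoVector P) {O : Set M} (hO : IsOpen O) (hf : CMDiff[O] ∞ f)
    (hx : x ∈ O) :
    ContMDiffAt I I.tangent ∞ (fun x ↦ (⟨x, hamiltonianField P f x⟩ : TangentBundle I M)) x := by
  refine contMDiffAt_of_derivAlong fun h hh ↦ ?_
  have h1 : derivAlong (hamiltonianField P f) h = fun x ↦ -pairing P f h x := by
    ext x
    rw [derivAlong, hamiltonianField, map_neg, pairing]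
  rw [h1]
  exact ((hP.contMDiffOn_pairing hO hf hh.contMDiffOn).contMDiffAt (hO.mem_nhds hx)).neg

end HamiltonianFields

end JacobiMaupertuis

end

open JacobiMaupertuis in
theorem theorem3p2
    {E : Type*} [NormedAddCommGroup E] [NormedSpace ℝ E] [FiniteDimensional ℝ E]
    {Q : Type*} [TopologicalSpace Q] [T2Space Q] [ChartedSpace E Q] [IsManifold 𝓘(ℝ, E) ∞ Q]
    {F : Type*} [NormedAddCommGroup F] [NormedSpace ℝ F] [FiniteDimensional ℝ F]
    {A : Q → Type*} [TopologicalSpace (TotalSpace F A)]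
    [∀ q, TopologicalSpace (A q)] [∀ q, AddCommGroup (A q)] [∀ q, Module ℝ (A q)]
    [∀ q, IsTopologicalAddGroup (A q)] [∀ q, ContinuousSMul ℝ (A q)]
    [FiberBundle F A] [VectorBundle ℝ F A] [ContMDiffVectorBundle ∞ F A 𝓘(ℝ, E)]
    (P : TwoTensorField (dualModel E F) (DualBundle F A)) (hP : IsLinearPoisson P)
    (g : ContMDiffRiemannianMetric 𝓘(ℝ, E) ∞ F A)
    (V : Q → ℝ) (hV : ContMDiff 𝓘(ℝ, E) 𝓘(ℝ, ℝ) ∞ V)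
    (e : ℝ) (hne : {q : Q | V q < e}.Nonempty)
    (W S : Set (DualBundle F A)) (hW : W = dualOver F A V e)
    (hS : S = sphereBundle F g.inner V e)
    (HH κ : DualBundle F A → ℝ) (hHH : HH = mechanical g.inner V)
    (hκ : κ = kinetic (jacobiMetric g.inner V e))
    (m : ℕ) (hm : m = Module.finrank ℝ E + Module.finrank ℝ F - 1) :
    S = {α | α ∈ W ∧ HH α = e} ∧
    (∃ (_ : ChartedSpace (EuclideanSpace ℝ (Fin m)) S) (_ : IsManifold (𝓡 m) ∞ S),
      -- codimension-one embedded submanifold and its tangent spaces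
      Manifold.IsSmoothEmbedding (𝓡 m) (dualModel E F) ∞ (Subtype.val : S → DualBundle F A) ∧
      (∀ α : S,
        (mfderiv (𝓡 m) (dualModel E F) (Subtype.val : S → DualBundle F A) α).range
          = (mvfderiv (dualModel E F) HH α.1).ker ∧
        (mfderiv (𝓡 m) (dualModel E F) (Subtype.val : S → DualBundle F A) α).range
          = (mvfderiv (dualModel E F) κ α.1).ker) ∧
      -- fibres and smooth local triviality over `{V < e}`
      (∀ q : Q, V q < e → ∀ α : A q →L[ℝ] ℝ,
        (⟨q, α⟩ : DualBundle F A) ∈ S ↔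
          √(dualNormSq (g.inner q) α) = √(2 * (e - V q))) ∧
      (∀ k : ℕ, Module.finrank ℝ F = k + 1 → ∀ q : Q, V q < e →
        ∃ t : Trivialization (Metric.sphere (0 : EuclideanSpace ℝ (Fin (k + 1))) 1)
            (fun α : S ↦ α.1.1),
          q ∈ t.baseSet ∧
          ContMDiffOn (𝓡 m) (𝓘(ℝ, E).prod (𝓡 k)) ∞ t t.source ∧
          ContMDiffOn (𝓘(ℝ, E).prod (𝓡 k)) (𝓡 m) ∞ t.toOpenPartialHomeomorph.symm t.target) ∧
      -- Hamiltonian vector fields along `S`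
      (∀ α : S,
        hamiltonianField P HH α.1 ∈
          (mfderiv (𝓡 m) (dualModel E F) (Subtype.val : S → DualBundle F A) α).range ∧
        hamiltonianField P κ α.1 ∈
          (mfderiv (𝓡 m) (dualModel E F) (Subtype.val : S → DualBundle F A) α).range ∧
        hamiltonianField P HH α.1 = (2 * (e - V α.1.1)) • hamiltonianField P κ α.1) ∧
      -- Jacobi structure on `S`
      (∃ (Λ : TwoTensorField (𝓡 m) S) (R : (α : S) → TangentSpace (𝓡 m) α),
        IsJacobi Λ R ∧
        (∀ (α : S) (β : TangentSpace (dualModel E F) α.1 →L[ℝ] ℝ),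
          mfderiv (𝓡 m) (dualModel E F) (Subtype.val : S → DualBundle F A) α
              (Λ α (β ∘L mfderiv (𝓡 m) (dualModel E F)
                (Subtype.val : S → DualBundle F A) α))
            = (P α.1 + (1 / (2 * (e - V α.1.1))) •
                wedge (liouville E α.1) (hamiltonianField P HH α.1)) β) ∧
        (∀ α : S,
          mfderiv (𝓡 m) (dualModel E F) (Subtype.val : S → DualBundle F A) α (R α)
            = -(1 / (2 * (e - V α.1.1))) • hamiltonianField P HH α.1))) ∧
    -- reparametrization of trajectories
    (∀ (c ce : ℝ → DualBundle F A) (J Je : Set ℝ),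
      IsTrajectory (hamiltonianField P HH) W c J →
      IsTrajectory (hamiltonianField P κ) W ce Je →
      c 0 ∈ S → ce 0 = c 0 →
      ∃ h : ℝ → ℝ, h 0 = 0 ∧ StrictMonoOn h J ∧
        (∀ s ∈ J, HasDerivAt h (2 * (e - V (c s).1)) s) ∧
        (∀ s ∈ J, h s ∈ Je → c s = ce (h s)) ∧
        (IsMaximalTrajectory (hamiltonianField P κ) W ce Je → MapsTo h J Je) ∧
        (IsMaximalTrajectory (hamiltonianField P κ) W ce Je →
          IsMaximalTrajectory (hamiltonianField P HH) W c J → BijOn h J Je)) := by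
  have : T2Space (DualBundle F A) := t2Space_totalSpace
  subst hm
  have hV' : Continuous V := hV.continuous
  have hSW : S ⊆ W := by rw [hS, hW]; exact fun α hα ↦ hα.1
  have hS_iff : ∀ α, α ∈ S ↔ α ∈ W ∧ HH α = e := fun α ↦ by
    rw [hS, hW, hHH, mem_sphereBundle_iff_mechanical]
  have hS_iff' : ∀ α, α ∈ S ↔ α ∈ jacobiCone g V e ∧ jacobiNorm g V e α = 1 := fun α ↦ by
    rw [hS, mem_sphereBundle_iff_jacobiNorm]
  have hpos : ∀ α ∈ W, 0 < 2 * (e - V α.1) := fun α hα ↦ by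
    rw [hW] at hα
    exact mul_pos two_pos (sub_pos.2 hα)
  have hWo : IsOpen W := hW ▸ isOpen_dualOver hV'
  have hHH_smooth : ContMDiff (dualModel E F) 𝓘(ℝ, ℝ) ∞ HH := hHH ▸ contMDiff_mechanical g hV
  have hκ_smooth : ContMDiffOn (dualModel E F) 𝓘(ℝ, ℝ) ∞ κ W := by
    rw [hκ, hW]
    exact contMDiffOn_kinetic_jacobiMetric g hV
  have hdκ : ∀ α ∈ S, mvfderiv (dualModel E F) κ α
      = mvfderiv (dualModel E F) (jacobiNorm g V e) α := fun α hα ↦ by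
    rw [hκ]
    exact mvfderiv_kinetic_jacobiMetric g hV (hS ▸ hα)
  have hdHH : ∀ α ∈ S, mvfderiv (dualModel E F) HH α
      = (2 * (e - V α.1)) • mvfderiv (dualModel E F) κ α := fun α hα ↦ by
    rw [hκ, hHH]
    exact mvfderiv_mechanical g hV (hS ▸ hα)
  have hXHH : ∀ α ∈ S, hamiltonianField P HH α = (2 * (e - V α.1)) • hamiltonianField P κ α :=
    fun α hα ↦ hamiltonianField_eq_smul (hdHH α hα)
  have hμ := isNormedCone_jacobiNorm g e hV
  refine ⟨ext hS_iff, ?_, ?_⟩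
  · obtain ⟨hch, hman, hι⟩ : ∃ (_ : ChartedSpace (EuclideanSpace ℝ
        (Fin (Module.finrank ℝ E + Module.finrank ℝ F - 1))) S)
        (_ : IsManifold (𝓡 (Module.finrank ℝ E + Module.finrank ℝ F - 1)) ∞ S),
        Manifold.IsSmoothEmbedding (𝓡 (Module.finrank ℝ E + Module.finrank ℝ F - 1))
          (dualModel E F) ∞ (Subtype.val : S → DualBundle F A) := by
      rw [hS]
      exact exists_isSmoothEmbedding_sphereBundle g hV
    have hrange : ∀ α : S, (mfderiv (𝓡 (Module.finrank ℝ E + Module.finrank ℝ F - 1))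
        (dualModel E F) (Subtype.val : S → DualBundle F A) α).range
          = (mvfderiv (dualModel E F) κ α.1).ker := fun α ↦ by
      rw [hdκ α α.2]
      exact hμ.range_mfderiv_coe hS_iff' hι α
    have hker : ∀ α ∈ S, ∀ w, w ∈ (mvfderiv (dualModel E F) HH α).ker
        ↔ w ∈ (mvfderiv (dualModel E F) κ α).ker := fun α hα w ↦ by
      rw [hdHH α hα]
      exact smul_eq_zero.trans (or_iff_right (hpos α (hSW hα)).ne')
    refine ⟨hch, hman, hι, fun α ↦ ⟨?_, hrange α⟩, fun q hq α ↦ ?_, fun k hk q hq ↦ ?_,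
      fun α ↦ ⟨?_, ?_, hXHH α α.2⟩, ?_⟩
    · rw [hrange]
      exact Submodule.ext fun w ↦ (hker α α.2 w).symm
    · rw [hS]
      exact mem_sphereBundle_iff_sqrt g hq α
    · exact exists_trivialization_sphereBundle g hS hι hV hk hq
    · rw [hrange]
      exact (hker α α.2 _).1 (hP.mvfderiv_hamiltonianField_self HH α)
    · rw [hrange]
      exact hP.mvfderiv_hamiltonianField_self κ α
    · have hhom : IsHomogeneous P fiberSMul (jacobiCone g V e) :=
        hP.isHomogeneous fun α hα ↦ (kinetic_pos_iff g α).1 hα.2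
      obtain ⟨Λ, R, hΛ, hΛι, hRι⟩ := hμ.exists_isJacobi hS_iff' hι hP.toIsPoisson hhom
      have hXρ : ∀ α ∈ S, hamiltonianField P (jacobiNorm g V e) α
          = (1 / (2 * (e - V α.1))) • hamiltonianField P HH α := fun α hα ↦ by
        rw [hXHH α hα, smul_smul, one_div_mul_cancel (hpos α (hSW hα)).ne', one_smul,
          hamiltonianField, hamiltonianField, hdκ α hα]
      refine ⟨Λ, R, hΛ, fun α β ↦ (hΛι α β).trans ?_, fun α ↦ (hRι α).trans ?_⟩
      · rw [hXρ α α.2, wedge_smul_right]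
        rfl
      · rw [hXρ α α.2, neg_smul]
  · intro c ce J Je hc hce hc0 hce0
    have hcS : MapsTo c J S := fun s hs ↦ (hS_iff _).2 ⟨hc.mapsTo hs, by
      rw [eq_of_isMIntegralCurveOn hc.isOpen hc.ordConnected hc.integral
        (fun s _ ↦ hHH_smooth.mdifferentiable (by simp) _)
        (fun s _ ↦ hP.mvfderiv_hamiltonianField_self HH _) hs hc.zero_mem]
      exact ((hS_iff _).1 hc0).2⟩
    have hceS : MapsTo ce Je S := fun s hs ↦ by
      have h1 : κ (ce s) = κ (ce 0) :=
        eq_of_isMIntegralCurveOn hce.isOpen hce.ordConnected hce.integral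
          (fun s hs ↦ (hκ_smooth.contMDiffAt (hWo.mem_nhds (hce.mapsTo hs))).mdifferentiableAt
            (by simp))
          (fun s _ ↦ hP.mvfderiv_hamiltonianField_self κ _) hs hce.zero_mem
      have h2 : ce 0 ∈ S := hce0 ▸ hc0
      rw [hS, hκ, hW] at *
      exact ⟨hce.mapsTo hs, h1.trans h2.2⟩
    refine exists_reparametrization_bijOn (σ := fun α : DualBundle F A ↦ 2 * (e - V α.1))
      (fun α _ ↦ (hP.contMDiffAt_hamiltonianField isOpen_univ hHH_smooth.contMDiffOn
        (mem_univ α)).of_le (by simp))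
      (fun α hα ↦ (hP.contMDiffAt_hamiltonianField hWo hκ_smooth (hSW hα)).of_le (by simp))
      ?_ (fun α hα ↦ hpos α (hSW hα)) hXHH hc hce hcS hceS hce0
    exact (continuous_const.mul (continuous_const.sub
      (hV'.comp (FiberBundle.continuous_proj _ _)))).continuousOn
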